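/- Consider the symmetric simple exclusion process on $\mathbb{Z}$ started from the configuration $O$ in which every negative site is occupied by one particle and every non-negative site is empty: each particle attempts to jump one site to the right at rate $1/2$ and one site to the left at rate $1/2$, and an attempt succeeds if and only if the destination site is empty. Let $\mathcal{U}_0$ be the (countable) set of configurations in which the number of particles in $[0,\infty)$ is finite and equal to the number of holes in $(-\infty,0)$. Let $X=(X_t)_{t\ge 0}$ be this process, that is, the continuous-time Markov jump process on $\mathcal{U}_0$ with $X_0=O$ which jumps from $x$ to $y$ at rate $1/2$ if $y$ is obtained from $x$ by moving one particle to an empty neighbouring site, and at rate $0$ for every other $y\neq x$. For $x\in\mathcal{U}_0$ let $D(x)$ be the least number of such jumps needed to get from $O$ to $x$, and let $D_t=D(X_t)$. Then $$\frac{D_t}{t}\longrightarrow\frac12\quad\text{almost surely as } t\to\infty.$$ -/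

import Mathlib

open MeasureTheory Filter Topology
open scoped NNReal ENNReal

noncomputable section

namespace Exclusion

/-- The states of the exclusion process that can be reached from the origin. A configuration of
particles on `ℤ` is given by its set of occupied sites; it belongs to this state space when the
number of particles in `[0, ∞)` is finite and equal to the number of holes in `(-∞, 0)`. -/
def State : Type :=
  {x : Set ℤ // (x ∩ Set.Ici 0).Finite ∧ (Set.Iio 0 \ x).Finite ∧
    (x ∩ Set.Ici 0).ncard = (Set.Iio 0 \ x).ncard}

/-- The set of occupied sites of a state. -/
def State.occ (x : State) : Set ℤ := x.1

/-- The state space is countable, and carries the discrete σ-algebra. -/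
instance : Countable State := by
  have h : Function.Injective (fun x : State =>
      ((x.2.1.toFinset, x.2.2.1.toFinset) : Finset ℤ × Finset ℤ)) := by
    intro x y hxy
    simp only [Prod.mk.injEq, Set.Finite.toFinset_inj] at hxy
    obtain ⟨h1, h2⟩ := hxy
    apply Subtype.ext
    ext i
    rcases lt_or_ge i 0 with hi | hi
    · have := Set.ext_iff.1 h2 i
      simp only [Set.mem_sdiff, Set.mem_Iio, hi, true_and] at this
      exact not_iff_not.1 this
    · have := Set.ext_iff.1 h1 i
      simpa only [Set.mem_inter_iff, Set.mem_Ici, hi, and_true] using this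
  exact h.countable

instance : MeasurableSpace State := ⊤

/-- The origin `O`: every negative site is occupied, every non-negative site is empty. -/
def origin : State :=
  ⟨Set.Iio 0, by
    have h1 : (Set.Iio (0 : ℤ) ∩ Set.Ici 0) = ∅ := by
      ext i; simp
    have h2 : (Set.Iio (0 : ℤ) \ Set.Iio 0) = ∅ := by simp
    rw [h1, h2]
    simp⟩

/-- `Moves x i j y`: in the state `x` there is a particle at `i` and a hole at `j`, and `y` is
obtained from `x` by moving that particle from `i` to `j`. -/
def Moves (x : State) (i j : ℤ) (y : State) : Prop :=
  i ∈ x.occ ∧ j ∉ x.occ ∧ y.occ = insert j (x.occ \ {i})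

/-- `y` is obtained from `x` by a jump of one particle one site to the right. -/
def RightJump (x y : State) : Prop := ∃ i, Moves x i (i + 1) y

/-- `y` is obtained from `x` by a jump of one particle one site to the left. -/
def LeftJump (x y : State) : Prop := ∃ i, Moves x i (i - 1) y

/-- The number of particles with a hole immediately to their right. -/
def numRight (x : State) : ℕ := {i | i ∈ x.occ ∧ i + 1 ∉ x.occ}.ncard

/-- The number of particles with a hole immediately to their left. -/
def numLeft (x : State) : ℕ := {i | i ∈ x.occ ∧ i - 1 ∉ x.occ}.ncard

open Classical in
/-- The rate at which the exclusion process jumps from `x` to `y`: each possible jump to the right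
occurs at rate `p`, each possible jump to the left at rate `1 - p`. -/
def jumpRate (p : ℝ) (x y : State) : ℝ :=
  if RightJump x y then p else if LeftJump x y then 1 - p else 0

/-- The total rate of jumps out of `x`, i.e. the sum of `jumpRate p x y` over all `y`. -/
def totalRate (p : ℝ) (x : State) : ℝ := p * numRight x + (1 - p) * numLeft x

/-- The graph on the states in which two states are neighbours when one jump of a particle leads
from one to the other. -/
def stateGraph : SimpleGraph State :=
  SimpleGraph.fromRel fun x y => RightJump x y ∨ LeftJump x y

/-- The distance of a state from the origin: the least number of jumps needed to get from the
origin to it (every state can be reached). -/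
def D (x : State) : ℕ := stateGraph.dist origin x

/-- The information given by the states `Y 0, …, Y n` and the holding times `S 0, …, S (n - 1)`,
as a σ-algebra. -/
abbrev past {Ω : Type*} (Y : ℕ → Ω → State) (S : ℕ → Ω → ℝ) (n : ℕ) : MeasurableSpace Ω :=
  (⨆ i ≤ n, MeasurableSpace.comap (Y i) inferInstance) ⊔
    (⨆ i < n, MeasurableSpace.comap (S i) inferInstance)

/-- `X` is a version of the exclusion process with parameter `p` (`0 < p ≤ 1`) started from the
origin: the continuous-time Markov jump process with initial state `origin` and jump rates
`jumpRate p`, given by its successive states `Y 0, Y 1, …` and the holding times `S 0, S 1, …` in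
them. Given the past up to the `n`-th jump and `Y n = x`, the holding time `S n` is exponential with
parameter `totalRate p x`, and the next state `Y (n + 1)` is independent of it and equal to `y` with
probability `jumpRate p x y / totalRate p x`. The process is in state `Y n` from the time
`S 0 + … + S (n - 1)` of the `n`-th jump until the time `S 0 + … + S n` of the next one. (Nothing is
required of `X` after the supremum of the jump times, should that be finite.) -/
def IsExclusionProcess {Ω : Type*} [MeasurableSpace Ω] (p : ℝ) (P : Measure Ω)
    (X : ℝ≥0 → Ω → State) : Prop :=
  ∃ (Y : ℕ → Ω → State) (S : ℕ → Ω → ℝ),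
    (∀ n, Measurable (Y n)) ∧ (∀ n, Measurable (S n)) ∧
    (∀ᵐ ω ∂P, Y 0 ω = origin) ∧
    (∀ (n : ℕ) (A : Set Ω), MeasurableSet[past Y S n] A →
      ∀ (x y : State) (u : ℝ), 0 ≤ u →
        P (A ∩ {ω | Y n ω = x} ∩ {ω | u < S n ω ∧ Y (n + 1) ω = y}) =
          P (A ∩ {ω | Y n ω = x}) *
            ENNReal.ofReal (Real.exp (-(totalRate p x * u)) *
              (jumpRate p x y / totalRate p x))) ∧
    (∀ᵐ ω ∂P, ∀ (n : ℕ) (t : ℝ≥0),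
      ∑ k ∈ Finset.range n, S k ω ≤ t → (t : ℝ) < ∑ k ∈ Finset.range (n + 1), S k ω →
        X t ω = Y n ω)

end Exclusion

end

/-!
The proof compares the process, along its jump times, with the clock `τ n`, the sum of the mean
holding times of the first `n` states `Y 0, …, Y (n - 1)`.

The distance `D x` is the total displacement of the particles (`D_eq_displacement`), so it changes
by `±1` at each jump. A configuration goes from occupied to empty once more than from empty to
occupied, so there is always exactly one more possible jump to the right than to the left
(`numRight_eq`), and the drift of the distance is `1 / 2` per unit of time. Hence, with
`T n = S 0 + … + S (n - 1)`, both `M n = D (Y n) - τ n / 2` and `N n = T n - τ n` are martingales,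
whose increments have bounded conditional second moments (`condExp_distIncr`, `condExp_timeIncr`
and the bounds on the squares).

The number of jumps is not bounded by a multiple of the clock, so this alone does not make the
martingales negligible compared with `τ`. But `n` particles that can jump to the left force a
displacement of order `n ^ 2`, so the total rate of jumps is at most of order `√(1 + D)`
(`totalRate_sq_le`), which is about `√(1 + τ)`. This makes
`(1 + (M ^ 2 + N ^ 2) / (1 + τ) ^ (7 / 4)) * exp (192 * (1 + τ) ^ (-1 / 4))`
a nonnegative supermartingale (`supermartingale_lyapunov`): each step adds at most
`8 / (1 + τ) ^ (7 / 4)` to the first factor, and the decrease of the second factor pays for it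
(`one_add_mul_exp_le`). The exponent `7 / 4` may be any number between `3 / 2` (for the sum of the
additions to converge) and `2` (for the conclusion). By the martingale convergence theorem the
supermartingale is almost surely bounded, so `M` and `N` are `o(τ)`.

Since `D (Y n) ≤ n`, the mean holding times are bounded below by a multiple of `1 / (n + 1)`, so
`τ n → ∞` (`tendsto_clock`). Therefore `T n ∼ τ n` tends to infinity, which also excludes
explosion, and `D (Y n) ∼ τ n / 2 ∼ T n / 2`. As `T (n + 1) / T n → 1`, the limit along the jump
times is the limit along all times (`tendsto_div_of_tendsto_jump`).
-/

open MeasureTheory Filter Topology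
open scoped NNReal ENNReal

namespace Exclusion

/-! ### The distance from the origin and the number of possible jumps -/

open Classical in
/-- The difference between the occupation numbers of a set of occupied sites and those of the
origin. -/
noncomputable def charge (s : Set ℤ) (k : ℤ) : ℤ :=
  (if k ∈ s then 1 else 0) - (if k < 0 then 1 else 0)

theorem support_charge (s : Set ℤ) :
    Function.support (charge s) = s ∩ Set.Ici 0 ∪ Set.Iio 0 \ s := by
  ext k
  by_cases h1 : k ∈ s <;> by_cases h2 : k < 0 <;> simp [charge, h1, h2]
  omega

theorem finite_support_charge (x : State) : (Function.support (charge x.occ)).Finite := by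
  rw [support_charge]
  exact x.2.1.union x.2.2.1

theorem finsum_charge (s : Set ℤ) (h1 : (s ∩ Set.Ici 0).Finite) (h2 : (Set.Iio 0 \ s).Finite) :
    ∑ᶠ k, charge s k = (s ∩ Set.Ici 0).ncard - (Set.Iio 0 \ s).ncard := by
  have hd : Disjoint (s ∩ Set.Ici 0) (Set.Iio 0 \ s) := by
    rw [Set.disjoint_left]
    rintro k ⟨hk, _⟩ ⟨_, hk'⟩
    exact hk' hk
  rw [← finsum_mem_support, support_charge, finsum_mem_union hd h1 h2]
  have e1 : ∑ᶠ k ∈ s ∩ Set.Ici 0, charge s k = ∑ᶠ k ∈ s ∩ Set.Ici 0, (1 : ℤ) := by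
    refine finsum_mem_congr rfl ?_
    rintro k ⟨hk, hk'⟩
    simp [charge, hk, not_lt.2 (Set.mem_Ici.1 hk')]
  have e2 : ∑ᶠ k ∈ Set.Iio 0 \ s, charge s k = ∑ᶠ k ∈ Set.Iio 0 \ s, (-1 : ℤ) := by
    refine finsum_mem_congr rfl ?_
    rintro k ⟨hk, hk'⟩
    simp [charge, hk', Set.mem_Iio.1 hk]
  rw [e1, e2, finsum_mem_eq_finite_toFinset_sum _ h1, finsum_mem_eq_finite_toFinset_sum _ h2,
    Set.ncard_eq_toFinset_card _ h1, Set.ncard_eq_toFinset_card _ h2]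
  simp
  ring

theorem charge_insert_sdiff {s : Set ℤ} {i j : ℤ} (hi : i ∈ s) (hj : j ∉ s) :
    charge (insert j (s \ {i})) = charge s + Pi.single j 1 - Pi.single i 1 := by
  have hij : i ≠ j := fun h => hj (h ▸ hi)
  funext k
  by_cases h1 : k = i
  · subst h1
    simp [charge, hi, hij]
  · by_cases h2 : k = j
    · subst h2
      simp [charge, hj, h1]
      ring
    · have : k ∈ insert j (s \ {i}) ↔ k ∈ s := by simp [h1, h2]
      by_cases h3 : k ∈ s
      · simp [charge, this.2 h3, h1, h2, h3]
      · simp [charge, mt this.1 h3, h1, h2, h3]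

theorem finite_support_single (i : ℤ) :
    (Function.support (Pi.single i 1 : ℤ → ℤ)).Finite :=
  (Set.finite_singleton i).subset Pi.support_single_subset

/-- A state in which the move of a particle from `i` to `j` is possible. -/
theorem exists_moves (x : State) {i j : ℤ} (hi : i ∈ x.occ) (hj : j ∉ x.occ) :
    ∃ y, Moves x i j y := by
  set s : Set ℤ := insert j (x.occ \ {i}) with hs
  have hc := charge_insert_sdiff hi hj
  have hx := finite_support_charge x
  have hfin : (Function.support (charge s)).Finite := by
    rw [hc]
    refine ((hx.union (finite_support_single j)).union (finite_support_single i)).subset ?_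
    refine (Function.support_sub _ _).trans (Set.union_subset_union_left _ ?_)
    exact Function.support_add _ _
  have hfin' := hfin
  rw [support_charge] at hfin'
  have h1 := hfin'.subset Set.subset_union_left
  have h2 := hfin'.subset Set.subset_union_right
  refine ⟨⟨s, h1, h2, ?_⟩, hi, hj, rfl⟩
  have hsum := finsum_charge s h1 h2
  have hsx := finsum_charge x.occ x.2.1 x.2.2.1
  have hx0 : (x.occ ∩ Set.Ici 0).ncard = (Set.Iio 0 \ x.occ).ncard := x.2.2.2
  have : ∑ᶠ k, charge s k = ∑ᶠ k, charge x.occ k := by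
    rw [hc]
    simp only [Pi.sub_apply, Pi.add_apply]
    rw [finsum_sub_distrib, finsum_add_distrib hx (finite_support_single j)]
    · have h : ∀ i : ℤ, ∑ᶠ k, (Pi.single i 1 : ℤ → ℤ) k = 1 := by
        intro i
        rw [finsum_eq_single _ i (fun k hk => by simp [hk])]
        simp
      rw [h, h, add_sub_cancel_right]
    · exact (hx.union (finite_support_single j)).subset (Function.support_add _ _)
    · exact finite_support_single i
  rw [this, hsx, hx0] at hsum
  have : ((s ∩ Set.Ici 0).ncard : ℤ) = (Set.Iio 0 \ s).ncard := by linarith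
  exact_mod_cast this

/-- The total displacement of the particles with respect to the origin. -/
noncomputable def displacement (x : State) : ℤ := ∑ᶠ k, k * charge x.occ k

theorem mul_charge_nonneg (s : Set ℤ) (k : ℤ) : 0 ≤ k * charge s k := by
  by_cases h1 : k ∈ s <;> by_cases h2 : k < 0 <;> simp [charge, h1, h2] <;> omega

theorem displacement_nonneg (x : State) : 0 ≤ displacement x :=
  finsum_nonneg fun k => mul_charge_nonneg _ k

theorem displacement_origin : displacement origin = 0 := by
  have : ∀ k : ℤ, k * charge origin.occ k = 0 := by
    intro k
    simp [charge, State.occ, origin]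
  simp [displacement, this]

theorem Moves.displacement_eq {x y : State} {i j : ℤ} (h : Moves x i j y) :
    displacement y = displacement x + j - i := by
  obtain ⟨hi, hj, hy⟩ := h
  have hx : (Function.support fun k => k * charge x.occ k).Finite :=
    (finite_support_charge x).subset (Function.support_mul_subset_right _ _)
  have hsing : ∀ i : ℤ, (Function.support fun k => k * (Pi.single i 1 : ℤ → ℤ) k).Finite :=
    fun i => (finite_support_single i).subset (Function.support_mul_subset_right _ _)
  unfold displacement
  rw [hy, charge_insert_sdiff hi hj]
  simp only [Pi.sub_apply, Pi.add_apply, mul_sub, mul_add]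
  rw [finsum_sub_distrib, finsum_add_distrib hx (hsing j)]
  · have : ∀ i : ℤ, ∑ᶠ k, k * (Pi.single i 1 : ℤ → ℤ) k = i := by
      intro i
      rw [finsum_eq_single _ i (fun k hk => by simp [hk])]
      simp
    rw [this, this]
  · exact (hx.union (hsing j)).subset (Function.support_add _ _)
  · exact hsing i

theorem RightJump.displacement_eq {x y : State} (h : RightJump x y) :
    displacement y = displacement x + 1 := by
  obtain ⟨i, hi⟩ := h
  rw [hi.displacement_eq]
  ring

theorem LeftJump.displacement_eq {x y : State} (h : LeftJump x y) :
    displacement y = displacement x - 1 := by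
  obtain ⟨i, hi⟩ := h
  rw [hi.displacement_eq]
  ring

theorem stateGraph_adj_iff {x y : State} :
    stateGraph.Adj x y ↔
      x ≠ y ∧ ((RightJump x y ∨ LeftJump x y) ∨ (RightJump y x ∨ LeftJump y x)) := by
  simp [stateGraph, SimpleGraph.fromRel_adj]

theorem displacement_le_of_adj {x y : State} (h : stateGraph.Adj x y) :
    displacement y ≤ displacement x + 1 := by
  rcases (stateGraph_adj_iff.1 h).2 with (h | h) | (h | h) <;> have := h.displacement_eq <;> omega

theorem LeftJump.adj {x y : State} (h : LeftJump x y) : stateGraph.Adj y x := by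
  refine stateGraph_adj_iff.2 ⟨?_, Or.inr (Or.inr h)⟩
  rintro rfl
  have := h.displacement_eq
  omega

theorem displacement_le_length {x y : State} (w : stateGraph.Walk x y) :
    displacement y ≤ displacement x + w.length := by
  induction w with
  | nil => simp
  | cons h w ih =>
    have := displacement_le_of_adj h
    simp only [SimpleGraph.Walk.length_cons]
    push_cast
    omega

theorem eq_origin_or_exists_leftJump (x : State) : x = origin ∨ ∃ y, LeftJump x y := by
  by_cases h : ∃ i, i ∈ x.occ ∧ i - 1 ∉ x.occ
  · obtain ⟨i, hi, hj⟩ := h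
    obtain ⟨y, hy⟩ := exists_moves x hi hj
    exact Or.inr ⟨y, i, hy⟩
  left
  push Not at h
  have hdown : ∀ (n : ℕ) (i : ℤ), i ∈ x.occ → i - n ∈ x.occ := by
    intro n i hi
    induction n with
    | zero => simpa using hi
    | succ n ih =>
      have := h _ ih
      push_cast
      rwa [← sub_sub]
  have hx0 : (x.occ ∩ Set.Ici 0).ncard = (Set.Iio 0 \ x.occ).ncard := x.2.2.2
  have hle : ∀ {i j : ℤ}, i ∈ x.occ → j ≤ i → j ∈ x.occ := by
    intro i j hi hij
    have := hdown (i - j).toNat i hi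
    rwa [Int.toNat_of_nonneg (by omega), sub_sub_cancel] at this
  have h1 : x.occ ∩ Set.Ici 0 = ∅ ∧ Set.Iio 0 \ x.occ = ∅ := by
    rcases Set.eq_empty_or_nonempty (x.occ ∩ Set.Ici 0) with he | ⟨i, hi, hi0⟩
    · refine ⟨he, ?_⟩
      rw [he, Set.ncard_empty] at hx0
      exact (Set.ncard_eq_zero x.2.2.1).1 hx0.symm
    · have he : Set.Iio 0 \ x.occ = ∅ := by
        rw [Set.eq_empty_iff_forall_notMem]
        rintro j ⟨hj, hj'⟩
        exact hj' (hle hi ((le_of_lt hj).trans hi0))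
      refine ⟨?_, he⟩
      rw [he, Set.ncard_empty] at hx0
      exact (Set.ncard_eq_zero x.2.1).1 hx0
  apply Subtype.ext
  change x.occ = Set.Iio 0
  refine Set.Subset.antisymm (fun i hi => ?_) (Set.sdiff_eq_empty.1 h1.2)
  by_contra hi'
  have : i ∈ x.occ ∩ Set.Ici 0 := ⟨hi, Set.mem_Ici.2 (not_lt.1 hi')⟩
  rw [h1.1] at this
  exact this

theorem exists_walk_length (n : ℕ) : ∀ x : State, displacement x = n →
    ∃ w : stateGraph.Walk x origin, w.length = n := by
  induction n with
  | zero =>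
    intro x hx
    rcases eq_origin_or_exists_leftJump x with rfl | ⟨y, hy⟩
    · exact ⟨SimpleGraph.Walk.nil, rfl⟩
    · have := hy.displacement_eq
      have := displacement_nonneg y
      simp only [Nat.cast_zero] at hx
      omega
  | succ n ih =>
    intro x hx
    rcases eq_origin_or_exists_leftJump x with rfl | ⟨y, hy⟩
    · rw [displacement_origin] at hx
      omega
    · obtain ⟨w, hw⟩ := ih y (by have := hy.displacement_eq; push_cast at hx; omega)
      exact ⟨SimpleGraph.Walk.cons hy.adj.symm w, by simp [hw]⟩

/-- The distance from the origin is the total displacement: a jump changes the displacement by at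
most one, and from any other state than the origin some particle can jump to the left. -/
theorem D_eq_displacement (x : State) : (D x : ℤ) = displacement x := by
  obtain ⟨n, hn⟩ := Int.eq_ofNat_of_zero_le (displacement_nonneg x)
  obtain ⟨w, hw⟩ := exists_walk_length n x hn
  apply le_antisymm
  · rw [hn]
    have := SimpleGraph.dist_le w.reverse
    rw [SimpleGraph.Walk.length_reverse, hw] at this
    exact_mod_cast this
  · obtain ⟨v, hv⟩ := w.reverse.reachable.exists_walk_length_eq_dist
    have := displacement_le_length v
    rw [hv, displacement_origin, zero_add] at this
    exact this

theorem RightJump.D_eq {x y : State} (h : RightJump x y) : D y = D x + 1 := by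
  have := h.displacement_eq
  rw [← D_eq_displacement, ← D_eq_displacement] at this
  exact_mod_cast this

theorem LeftJump.D_eq {x y : State} (h : LeftJump x y) : D x = D y + 1 := by
  have := h.displacement_eq
  rw [← D_eq_displacement, ← D_eq_displacement] at this
  omega

theorem D_origin : D origin = 0 := SimpleGraph.dist_self

theorem not_rightJump_of_leftJump {x y : State} (h : LeftJump x y) : ¬ RightJump x y := by
  intro h'
  have := h.D_eq
  have := h'.D_eq
  omega

/-- Far to the left all sites are occupied, far to the right all are empty. -/
theorem exists_bound (x : State) :
    ∃ N : ℕ, (∀ k : ℤ, k < -N → k ∈ x.occ) ∧ ∀ k : ℤ, (N : ℤ) < k → k ∉ x.occ := by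
  obtain ⟨N, hN⟩ : ∃ N : ℕ, ∀ k ∈ Function.support (charge x.occ), k.natAbs ≤ N := by
    obtain ⟨N, hN⟩ := ((finite_support_charge x).image Int.natAbs).bddAbove
    exact ⟨N, fun k hk => hN ⟨k, hk, rfl⟩⟩
  rw [support_charge] at hN
  refine ⟨N, fun k hk => ?_, fun k hk hk' => ?_⟩
  · by_contra hk'
    have := hN k (Or.inr ⟨by simp; omega, hk'⟩)
    omega
  · have := hN k (Or.inl ⟨hk', by simp; omega⟩)
    omega

theorem finite_right (x : State) : {i | i ∈ x.occ ∧ i + 1 ∉ x.occ}.Finite := by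
  obtain ⟨N, h1, h2⟩ := exists_bound x
  refine (Set.finite_Icc (-N - 1 : ℤ) N).subset ?_
  rintro i ⟨hi, hi'⟩
  constructor <;> by_contra! h
  · exact hi' (h1 _ (by omega))
  · exact h2 _ h hi

theorem finite_left (x : State) : {i | i ∈ x.occ ∧ i - 1 ∉ x.occ}.Finite := by
  obtain ⟨N, h1, h2⟩ := exists_bound x
  refine (Set.finite_Icc (-N : ℤ) N).subset ?_
  rintro i ⟨hi, hi'⟩
  constructor <;> by_contra! h
  · exact hi' (h1 _ (by omega))
  · exact h2 _ h hi

/-- There is one more possible jump to the right than to the left: reading the configuration from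
left to right, it goes from occupied to empty once more than from empty to occupied. -/
theorem numRight_eq (x : State) : numRight x = numLeft x + 1 := by
  classical
  obtain ⟨N, h1, h2⟩ := exists_bound x
  set I : Finset ℕ := Finset.range (2 * N + 2) with hI
  set e : ℕ → ℤ := fun n => (n : ℤ) - (N + 1) with he
  have hinj : Function.Injective e := fun a b h => by simp only [he] at h; omega
  have hR : {i | i ∈ x.occ ∧ i + 1 ∉ x.occ} =
      e '' ((I.filter fun n => e n ∈ x.occ ∧ e n + 1 ∉ x.occ : Finset ℕ) : Set ℕ) := by
    ext i
    simp only [Set.mem_ofPred_eq, Finset.coe_filter, Set.mem_image]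
    constructor
    · rintro ⟨hi, hi'⟩
      have l1 : -(N : ℤ) - 1 ≤ i := by by_contra! h; exact hi' (h1 _ (by omega))
      have l2 : i ≤ N := by by_contra! h; exact h2 _ h hi
      have : e (i + (N + 1)).toNat = i := by simp only [he]; omega
      exact ⟨(i + (N + 1)).toNat, ⟨by simp only [hI, Finset.mem_range]; omega,
        by rw [this]; exact ⟨hi, hi'⟩⟩, this⟩
    · rintro ⟨n, ⟨-, h⟩, rfl⟩
      exact h
  have hL : {i | i ∈ x.occ ∧ i - 1 ∉ x.occ} =
      (fun n => e n + 1) ''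
        ((I.filter fun n => e n + 1 ∈ x.occ ∧ e n ∉ x.occ : Finset ℕ) : Set ℕ) := by
    ext i
    simp only [Set.mem_ofPred_eq, Finset.coe_filter, Set.mem_image]
    constructor
    · rintro ⟨hi, hi'⟩
      have l1 : -(N : ℤ) ≤ i := by by_contra! h; exact hi' (h1 _ (by omega))
      have l2 : i ≤ N := by by_contra! h; exact h2 _ h hi
      have : e (i + N).toNat = i - 1 := by simp only [he]; omega
      refine ⟨(i + N).toNat, ⟨by simp only [hI, Finset.mem_range]; omega, ?_⟩, by rw [this]; ring⟩
      rw [this, sub_add_cancel]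
      exact ⟨hi, hi'⟩
    · rintro ⟨n, ⟨-, h⟩, rfl⟩
      simpa using h
  have cR : (numRight x : ℤ) = ∑ n ∈ I, if e n ∈ x.occ ∧ e n + 1 ∉ x.occ then (1 : ℤ) else 0 := by
    rw [numRight, hR, Set.ncard_image_of_injective _ hinj, Set.ncard_coe_finset]
    simp
  have cL : (numLeft x : ℤ) = ∑ n ∈ I, if e n + 1 ∈ x.occ ∧ e n ∉ x.occ then (1 : ℤ) else 0 := by
    rw [numLeft, hL, Set.ncard_image_of_injective _ (fun a b h => hinj (by simpa using h)),
      Set.ncard_coe_finset]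
    simp
  have tel := Finset.sum_range_sub' (fun n => if e n ∈ x.occ then (1 : ℤ) else 0) (2 * N + 2)
  have e0 : e 0 ∈ x.occ := h1 _ (by simp only [he]; omega)
  have eN : e (2 * N + 2) ∉ x.occ := h2 _ (by simp only [he]; push_cast; omega)
  simp only [e0, eN, if_true, if_false] at tel
  have key : (numRight x : ℤ) - numLeft x = 1 := by
    rw [sub_zero] at tel
    refine Eq.trans ?_ tel
    rw [cR, cL, ← Finset.sum_sub_distrib]
    refine Finset.sum_congr rfl fun n _ => ?_
    have : e (n + 1) = e n + 1 := by simp only [he]; push_cast; ring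
    rw [this]
    by_cases a : e n ∈ x.occ <;> by_cases b : e n + 1 ∈ x.occ <;> simp [a, b]
  omega

/-- A particle with a hole immediately to its left lies on a site whose distance from `0` is at most
the contribution to the displacement of that site or of the hole. -/
theorem sum_abs_left_le (x : State) :
    ∑ i ∈ (finite_left x).toFinset, |i| ≤ displacement x := by
  classical
  set A := (finite_left x).toFinset with hA
  -- the injection `g` sends the site `i` of a particle to itself if `0 < i`, and to the hole on
  -- its left otherwise
  set g : ℤ → ℤ := fun i => if 0 < i then i else i - 1 with hg
  have hinj : Set.InjOn g A := by
    intro a _ b _ h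
    simp only [hg] at h
    split_ifs at h <;> omega
  have hle : ∀ i ∈ A, |i| ≤ g i * charge x.occ (g i) := by
    intro i hi
    obtain ⟨h1, h2⟩ : i ∈ x.occ ∧ i - 1 ∉ x.occ := by simpa [hA] using hi
    by_cases h : 0 < i
    · simp [hg, h, charge, h1, abs_of_pos, not_lt.2 h.le]
    · have : i - 1 < 0 := by omega
      simp only [hg, h, charge, h2, this, if_true, if_false]
      rw [abs_of_nonpos (by omega)]
      omega
  calc ∑ i ∈ A, |i| ≤ ∑ i ∈ A, g i * charge x.occ (g i) := Finset.sum_le_sum hle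
    _ = ∑ k ∈ A.image g, k * charge x.occ k := by
        rw [Finset.sum_image hinj]
    _ ≤ ∑ k ∈ A.image g ∪ (finite_support_charge x).toFinset, k * charge x.occ k :=
        Finset.sum_le_sum_of_subset_of_nonneg Finset.subset_union_left
          fun k _ _ => mul_charge_nonneg _ k
    _ = displacement x := by
        refine (finsum_eq_sum_of_support_subset _ ?_).symm
        refine (Function.support_mul_subset_right _ _).trans fun k hk => ?_
        simp only [Finset.coe_union, Set.mem_union, Set.Finite.coe_toFinset]
        exact Or.inr hk

/-- All but `2 * m + 1` of the particles that can jump to the left have distance more than `m` from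
`0`, and so contribute at least `m + 1` to the displacement. -/
theorem numLeft_le (x : State) (m : ℕ) : (m + 1) * numLeft x ≤ (m + 1) * (2 * m + 1) + D x := by
  classical
  set A := (finite_left x).toFinset with hA
  have hcard : numLeft x = A.card := Set.ncard_eq_toFinset_card _ (finite_left x)
  have hsum := sum_abs_left_le x
  rw [← D_eq_displacement] at hsum
  have hterm : ∀ i ∈ A, ((m : ℤ) + 1) ≤
      (if i ∈ Finset.Icc (-m : ℤ) m then ((m : ℤ) + 1) else 0) + |i| := by
    intro i _
    split_ifs with h
    · have := abs_nonneg i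
      omega
    · rw [Finset.mem_Icc, ← abs_le] at h
      omega
  have h1 := Finset.sum_le_sum hterm
  rw [Finset.sum_const, Finset.sum_add_distrib, ← Finset.sum_filter, Finset.sum_const,
    nsmul_eq_mul, nsmul_eq_mul] at h1
  have h2 : (A.filter fun i => i ∈ Finset.Icc (-m : ℤ) m).card ≤ 2 * m + 1 := by
    refine (Finset.card_le_card (t := Finset.Icc (-m : ℤ) m) fun i hi =>
      (Finset.mem_filter.1 hi).2).trans ?_
    rw [Int.card_Icc]
    omega
  have h3 : ((A.filter fun i => i ∈ Finset.Icc (-m : ℤ) m).card : ℤ) * (m + 1) ≤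
      (2 * m + 1) * (m + 1) := mul_le_mul_of_nonneg_right (by exact_mod_cast h2) (by positivity)
  rw [hcard]
  zify
  linarith

theorem totalRate_half (x : State) : totalRate (1 / 2) x = numLeft x + 1 / 2 := by
  rw [totalRate, numRight_eq]
  push_cast
  ring

theorem half_le_totalRate (x : State) : 1 / 2 ≤ totalRate (1 / 2) x := by
  rw [totalRate_half]
  have : (0 : ℝ) ≤ numLeft x := Nat.cast_nonneg _
  linarith

theorem totalRate_pos (x : State) : 0 < totalRate (1 / 2) x := by
  linarith [half_le_totalRate x]

/-- The total rate is at most of the order of the square root of the distance from the origin,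
because `n` particles with a hole to their left contribute to the displacement at least of the
order of `n ^ 2`. -/
theorem totalRate_sq_le (x : State) : totalRate (1 / 2) x ^ 2 ≤ 18 * (1 + D x) := by
  rw [totalRate_half]
  -- the bound of `numLeft_le` is optimal when `m` is of the order of the root of the distance
  set m := Nat.sqrt (D x) with hm
  have h1 := numLeft_le x m
  have h2 : m * m ≤ D x := Nat.sqrt_le _
  have h3 : D x < (m + 1) * (m + 1) := Nat.lt_succ_sqrt _
  have h4 : numLeft x ≤ 3 * m + 1 := by
    have : (m + 1) * numLeft x < (m + 1) * (3 * m + 2) := by nlinarith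
    have := lt_of_mul_lt_mul_left this (by omega)
    omega
  have h5 : (numLeft x : ℝ) ≤ 3 * m + 1 := by exact_mod_cast h4
  have h6 : (m : ℝ) * m ≤ D x := by exact_mod_cast h2
  have h7 : (0 : ℝ) ≤ numLeft x := Nat.cast_nonneg _
  have : ((numLeft x : ℝ) + 1 / 2) ^ 2 ≤ (3 * m + 3 / 2) ^ 2 :=
    pow_le_pow_left₀ (by linarith) (by linarith) 2
  nlinarith [sq_nonneg ((m : ℝ) - 1)]

theorem Moves.eq_of_eq {x y y' : State} {i j : ℤ} (h : Moves x i j y) (h' : Moves x i j y') :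
    y = y' :=
  Subtype.ext (h.2.2.trans h'.2.2.symm)

theorem Moves.source_eq {x y : State} {i j i' j' : ℤ} (h : Moves x i j y) (h' : Moves x i' j' y) :
    i = i' := by
  have h1 : i' ∉ y.occ := by
    rw [h'.2.2]
    rintro (h1 | h1)
    · exact h'.2.1 (h1 ▸ h'.1)
    · exact h1.2 rfl
  by_contra hne
  apply h1
  rw [h.2.2]
  exact Or.inr ⟨h'.1, fun h => hne h.symm⟩

theorem exists_bijOn_moves (x : State) (a : ℤ) :
    ∃ F : ℤ → State, Set.BijOn F {i | i ∈ x.occ ∧ i + a ∉ x.occ} {y | ∃ i, Moves x i (i + a) y} := by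
  classical
  have : ∀ i, ∃ y, i ∈ {i | i ∈ x.occ ∧ i + a ∉ x.occ} → Moves x i (i + a) y := by
    intro i
    by_cases h : i ∈ {i | i ∈ x.occ ∧ i + a ∉ x.occ}
    · obtain ⟨y, hy⟩ := exists_moves x h.1 h.2
      exact ⟨y, fun _ => hy⟩
    · exact ⟨origin, fun h' => absurd h' h⟩
  choose F hF using this
  refine ⟨F, fun i hi => ⟨i, hF i hi⟩, fun i hi j hj hij => ?_, ?_⟩
  · have h1 := hF i hi
    rw [hij] at h1
    exact h1.source_eq (hF j hj)
  · rintro y ⟨i, hi⟩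
    exact ⟨i, ⟨hi.1, hi.2.1⟩, (hF i ⟨hi.1, hi.2.1⟩).eq_of_eq hi⟩

theorem finite_rightJump (x : State) : {y | RightJump x y}.Finite := by
  obtain ⟨F, hF⟩ := exists_bijOn_moves x 1
  exact hF.image_eq ▸ (finite_right x).image F

theorem ncard_rightJump (x : State) : {y | RightJump x y}.ncard = numRight x := by
  obtain ⟨F, hF⟩ := exists_bijOn_moves x 1
  exact (hF.image_eq ▸ hF.injOn.ncard_image :)

theorem finite_leftJump (x : State) : {y | LeftJump x y}.Finite := by
  obtain ⟨F, hF⟩ := exists_bijOn_moves x (-1)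
  exact (hF.image_eq ▸ (finite_left x).image F :)

theorem ncard_leftJump (x : State) : {y | LeftJump x y}.ncard = numLeft x := by
  obtain ⟨F, hF⟩ := exists_bijOn_moves x (-1)
  exact (hF.image_eq ▸ hF.injOn.ncard_image :)

theorem jumpRate_of_rightJump {x y : State} (h : RightJump x y) : jumpRate (1 / 2) x y = 1 / 2 := by
  simp [jumpRate, h]

theorem jumpRate_of_leftJump {x y : State} (h : LeftJump x y) : jumpRate (1 / 2) x y = 1 / 2 := by
  simp only [jumpRate, not_rightJump_of_leftJump h, h, if_true, if_false]
  norm_num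

theorem jumpRate_of_not {x y : State} (h : ¬ RightJump x y) (h' : ¬ LeftJump x y) :
    jumpRate (1 / 2) x y = 0 := by
  simp [jumpRate, h, h']

/-! ### Transition probabilities of the jump chain -/

/-- `Y` and `S` are the successive states and the holding times of the symmetric exclusion process
started from the origin. -/
structure IsJumpChain {Ω : Type*} [MeasurableSpace Ω] (P : Measure Ω) (Y : ℕ → Ω → State)
    (S : ℕ → Ω → ℝ) : Prop where
  measurable_state : ∀ n, Measurable (Y n)
  measurable_time : ∀ n, Measurable (S n)
  init : ∀ᵐ ω ∂P, Y 0 ω = origin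
  transition : ∀ (n : ℕ) (A : Set Ω), MeasurableSet[past Y S n] A →
    ∀ (x y : State) (u : ℝ), 0 ≤ u →
      P (A ∩ {ω | Y n ω = x} ∩ {ω | u < S n ω ∧ Y (n + 1) ω = y}) =
        P (A ∩ {ω | Y n ω = x}) *
          ENNReal.ofReal (Real.exp (-(totalRate (1 / 2) x * u)) *
            (jumpRate (1 / 2) x y / totalRate (1 / 2) x))

section Fibers

variable {Ω ι : Type*} [MeasurableSpace Ω] {P : Measure Ω} [Countable ι] [MeasurableSpace ι]
  [MeasurableSingletonClass ι] {Y : Ω → ι}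

theorem measure_eq_tsum_fiber (hY : Measurable Y) {B : Set Ω} (hB : MeasurableSet B) :
    P B = ∑' x, P (B ∩ {ω | Y ω = x}) := by
  have hm : ∀ x, MeasurableSet (B ∩ {ω | Y ω = x}) :=
    fun x => hB.inter (hY (measurableSet_singleton x))
  rw [← measure_iUnion _ hm]
  · congr 1
    ext ω
    simp
  · intro x x' hx
    rw [Function.onFun, Set.disjoint_left]
    rintro ω ⟨-, h⟩ ⟨-, h'⟩
    exact hx (h.symm.trans h')

theorem setIntegral_congr_fiber (hY : Measurable Y) {A : Set Ω} (hA : MeasurableSet A)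
    {f g : Ω → ℝ} (hf : Integrable f P) (hg : Integrable g P)
    (h : ∀ x, ∫ ω in A ∩ {ω | Y ω = x}, f ω ∂P = ∫ ω in A ∩ {ω | Y ω = x}, g ω ∂P) :
    ∫ ω in A, f ω ∂P = ∫ ω in A, g ω ∂P := by
  have hm : ∀ x, MeasurableSet (A ∩ {ω | Y ω = x}) :=
    fun x => hA.inter (hY (measurableSet_singleton x))
  have hd : Pairwise (Function.onFun Disjoint fun x => A ∩ {ω | Y ω = x}) := by
    intro x x' hx
    rw [Function.onFun, Set.disjoint_left]
    rintro ω ⟨-, h⟩ ⟨-, h'⟩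
    exact hx (h.symm.trans h')
  have hU : A = ⋃ x, A ∩ {ω | Y ω = x} := by
    ext ω
    simp
  rw [hU, integral_iUnion hm hd hf.integrableOn, integral_iUnion hm hd hg.integrableOn]
  exact tsum_congr h

end Fibers

section Exponential

variable {Ω : Type*} [MeasurableSpace Ω] {μ : Measure Ω} {E : Ω → ℝ}

/-- The moments of a random variable with an exponential tail, for a measure of any total mass, so
that it applies to restrictions of a probability measure to events. -/
theorem lintegral_of_exponential_tail (hE : AEMeasurable E μ) (h0 : 0 ≤ᵐ[μ] E)
    (h : ∀ u, 0 ≤ u → μ {ω | u < E ω} = μ Set.univ * ENNReal.ofReal (Real.exp (-u))) {p : ℝ}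
    (hp : 0 < p) :
    ∫⁻ ω, ENNReal.ofReal (E ω ^ p) ∂μ = μ Set.univ * ENNReal.ofReal (p * Real.Gamma p) := by
  rw [lintegral_rpow_eq_lintegral_meas_lt_mul μ h0 hE hp]
  have h1 : ∫⁻ t in Set.Ioi (0 : ℝ), μ {ω | t < E ω} * ENNReal.ofReal (t ^ (p - 1)) =
      ∫⁻ t in Set.Ioi (0 : ℝ), μ Set.univ * ENNReal.ofReal (Real.exp (-t) * t ^ (p - 1)) := by
    refine setLIntegral_congr_fun measurableSet_Ioi fun t ht => ?_
    rw [h t (le_of_lt ht), mul_assoc, ← ENNReal.ofReal_mul (Real.exp_pos _).le]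
  have hmeas : Measurable fun t : ℝ => ENNReal.ofReal (Real.exp (-t) * t ^ (p - 1)) := by fun_prop
  rw [h1, lintegral_const_mul _ hmeas, ← ofReal_integral_eq_lintegral_ofReal,
    ← Real.Gamma_eq_integral hp, mul_left_comm, ← ENNReal.ofReal_mul hp.le]
  · exact Real.GammaIntegral_convergent hp
  · refine (ae_restrict_iff' measurableSet_Ioi).2 (ae_of_all _ fun t ht => ?_)
    exact mul_nonneg (Real.exp_pos _).le (Real.rpow_nonneg (le_of_lt ht) _)

theorem integral_of_exponential_tail (hE : AEMeasurable E μ) (h0 : 0 ≤ᵐ[μ] E)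
    (h : ∀ u, 0 ≤ u → μ {ω | u < E ω} = μ Set.univ * ENNReal.ofReal (Real.exp (-u))) :
    ∫ ω, E ω ∂μ = μ.real Set.univ := by
  have h1 := lintegral_of_exponential_tail hE h0 h one_pos
  simp only [Real.rpow_one, Real.Gamma_one, mul_one, ENNReal.ofReal_one] at h1
  rw [integral_eq_lintegral_of_nonneg_ae h0 hE.aestronglyMeasurable, h1, Measure.real]

theorem lintegral_sq_of_exponential_tail (hE : AEMeasurable E μ) (h0 : 0 ≤ᵐ[μ] E)
    (h : ∀ u, 0 ≤ u → μ {ω | u < E ω} = μ Set.univ * ENNReal.ofReal (Real.exp (-u))) :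
    ∫⁻ ω, ENNReal.ofReal (E ω ^ 2) ∂μ = μ Set.univ * ENNReal.ofReal 2 := by
  have h1 := lintegral_of_exponential_tail hE h0 h (p := 2) two_pos
  simpa only [Real.rpow_two, Real.Gamma_two, mul_one] using h1

theorem integral_sq_of_exponential_tail (hE : AEMeasurable E μ) (h0 : 0 ≤ᵐ[μ] E)
    (h : ∀ u, 0 ≤ u → μ {ω | u < E ω} = μ Set.univ * ENNReal.ofReal (Real.exp (-u))) :
    ∫ ω, E ω ^ 2 ∂μ = 2 * μ.real Set.univ := by
  rw [integral_eq_lintegral_of_nonneg_ae (ae_of_all _ fun _ => sq_nonneg _)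
    (hE.pow_const 2).aestronglyMeasurable, lintegral_sq_of_exponential_tail hE h0 h, Measure.real,
    ENNReal.toReal_mul, ENNReal.toReal_ofReal zero_le_two, mul_comm]

theorem memLp_two_of_exponential_tail [IsFiniteMeasure μ] (hE : AEMeasurable E μ)
    (h0 : 0 ≤ᵐ[μ] E)
    (h : ∀ u, 0 ≤ u → μ {ω | u < E ω} = μ Set.univ * ENNReal.ofReal (Real.exp (-u))) :
    MemLp E 2 μ := by
  rw [memLp_two_iff_integrable_sq hE.aestronglyMeasurable]
  refine ⟨(hE.pow_const 2).aestronglyMeasurable, ?_⟩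
  rw [hasFiniteIntegral_iff_ofReal (ae_of_all _ fun _ => sq_nonneg _),
    lintegral_sq_of_exponential_tail hE h0 h]
  finiteness

end Exponential

section Past

variable {Ω : Type*} {Y : ℕ → Ω → State} {S : ℕ → Ω → ℝ}

theorem past_mono (Y : ℕ → Ω → State) (S : ℕ → Ω → ℝ) : Monotone (past Y S) := by
  intro m n hmn
  refine sup_le_sup ?_ ?_
  · exact iSup₂_le fun i hi => le_iSup₂_of_le i (hi.trans hmn) le_rfl
  · exact iSup₂_le fun i hi => le_iSup₂_of_le i (hi.trans_le hmn) le_rfl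

theorem measurable_state_past {i n : ℕ} (hi : i ≤ n) : Measurable[past Y S n] (Y i) := by
  rw [measurable_iff_comap_le]
  exact le_sup_of_le_left (le_iSup₂_of_le i hi le_rfl)

theorem measurable_time_past {i n : ℕ} (hi : i < n) : Measurable[past Y S n] (S i) := by
  rw [measurable_iff_comap_le]
  exact le_sup_of_le_right (le_iSup₂_of_le i hi le_rfl)

end Past

namespace IsJumpChain

variable {Ω : Type*} [mΩ : MeasurableSpace Ω] {P : Measure Ω} {Y : ℕ → Ω → State}
  {S : ℕ → Ω → ℝ}

theorem past_le (h : IsJumpChain P Y S) (n : ℕ) : past Y S n ≤ mΩ := by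
  refine sup_le (iSup₂_le fun i _ => ?_) (iSup₂_le fun i _ => ?_)
  · exact (h.measurable_state i).comap_le
  · exact (h.measurable_time i).comap_le

/-- The filtration generated by the states and the holding times. -/
def filtration (h : IsJumpChain P Y S) : Filtration ℕ mΩ where
  seq := past Y S
  mono' := past_mono Y S
  le' := h.past_le

variable {n : ℕ} {A : Set Ω}

theorem measurableSet_state (h : IsJumpChain P Y S) (n : ℕ) (B : Set State) :
    MeasurableSet {ω | Y n ω ∈ B} :=
  h.measurable_state n (MeasurableSpace.measurableSet_top (s := B))

theorem measurableSet_fiber (h : IsJumpChain P Y S) (hA : MeasurableSet[past Y S n] A)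
    (x : State) : MeasurableSet (A ∩ {ω | Y n ω = x}) :=
  (h.past_le n _ hA).inter (h.measurableSet_state n {x})

theorem measurableSet_lt_time (h : IsJumpChain P Y S) (n : ℕ) (u : ℝ) :
    MeasurableSet {ω | u < S n ω} :=
  measurableSet_lt measurable_const (h.measurable_time n)

theorem measure_jump_mem (h : IsJumpChain P Y S) (hA : MeasurableSet[past Y S n] A) (x : State)
    {u : ℝ} (hu : 0 ≤ u) {B : Set State} (hB : B.Finite)
    (hr : ∀ y ∈ B, jumpRate (1 / 2) x y = 1 / 2) :
    P (A ∩ {ω | Y n ω = x} ∩ {ω | u < S n ω ∧ Y (n + 1) ω ∈ B}) =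
      P (A ∩ {ω | Y n ω = x}) *
        ENNReal.ofReal (Real.exp (-(totalRate (1 / 2) x * u)) *
          (B.ncard * (1 / 2) / totalRate (1 / 2) x)) := by
  classical
  have hU : A ∩ {ω | Y n ω = x} ∩ {ω | u < S n ω ∧ Y (n + 1) ω ∈ B} =
      ⋃ y ∈ hB.toFinset, A ∩ {ω | Y n ω = x} ∩ {ω | u < S n ω ∧ Y (n + 1) ω = y} := by
    ext ω
    simp
  rw [hU, measure_biUnion_finset]
  · have hc : ∀ y ∈ hB.toFinset,
        P (A ∩ {ω | Y n ω = x} ∩ {ω | u < S n ω ∧ Y (n + 1) ω = y}) =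
        P (A ∩ {ω | Y n ω = x}) *
        ENNReal.ofReal (Real.exp (-(totalRate (1 / 2) x * u)) *
          (1 / 2 / totalRate (1 / 2) x)) := by
      intro y hy
      rw [h.transition n A hA x y u hu, hr y (hB.mem_toFinset.1 hy)]
    rw [Finset.sum_congr rfl hc, Finset.sum_const, nsmul_eq_mul, mul_left_comm,
      ← Set.ncard_eq_toFinset_card B hB, ← ENNReal.ofReal_natCast,
      ← ENNReal.ofReal_mul (Nat.cast_nonneg _)]
    congr 2
    ring
  · intro y _ y' _ hy
    rw [Function.onFun, Set.disjoint_left]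
    rintro ω ⟨-, -, h⟩ ⟨-, -, h'⟩
    exact hy (h.symm.trans h')
  · intro y _
    exact (h.measurableSet_fiber hA x).inter
      ((h.measurableSet_lt_time n u).inter (h.measurableSet_state (n + 1) {y}))

theorem finite_jump (x : State) : {y | RightJump x y ∨ LeftJump x y}.Finite :=
  (finite_rightJump x).union (finite_leftJump x)

theorem ncard_jump (x : State) :
    ({y | RightJump x y ∨ LeftJump x y}.ncard : ℝ) * (1 / 2) = totalRate (1 / 2) x := by
  have : {y | RightJump x y ∨ LeftJump x y} = {y | RightJump x y} ∪ {y | LeftJump x y} := rfl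
  rw [this, Set.ncard_union_eq _ (finite_rightJump x) (finite_leftJump x), ncard_rightJump,
    ncard_leftJump, totalRate]
  · push_cast
    ring
  · rw [Set.disjoint_left]
    exact fun y hy hy' => not_rightJump_of_leftJump hy' hy

theorem measure_not_jump (h : IsJumpChain P Y S) (hA : MeasurableSet[past Y S n] A) (x : State)
    {u : ℝ} (hu : 0 ≤ u) :
    P (A ∩ {ω | Y n ω = x} ∩ {ω | u < S n ω ∧ Y (n + 1) ω ∉ {y | RightJump x y ∨ LeftJump x y}}) =
      0 := by
  have hU : A ∩ {ω | Y n ω = x} ∩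
      {ω | u < S n ω ∧ Y (n + 1) ω ∉ {y | RightJump x y ∨ LeftJump x y}} ⊆
      ⋃ y ∈ {y | RightJump x y ∨ LeftJump x y}ᶜ,
        A ∩ {ω | Y n ω = x} ∩ {ω | u < S n ω ∧ Y (n + 1) ω = y} := by
    rintro ω ⟨h1, h2, h3⟩
    exact Set.mem_iUnion₂.2 ⟨Y (n + 1) ω, h3, h1, h2, rfl⟩
  refine measure_mono_null hU ((measure_biUnion_null_iff (Set.to_countable _)).2 fun y hy => ?_)
  rw [h.transition n A hA x y u hu, jumpRate_of_not (fun h => hy (Or.inl h))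
    (fun h => hy (Or.inr h))]
  simp

theorem measure_lt_time (h : IsJumpChain P Y S) (hA : MeasurableSet[past Y S n] A) (x : State)
    {u : ℝ} (hu : 0 ≤ u) :
    P (A ∩ {ω | Y n ω = x} ∩ {ω | u < S n ω}) =
      P (A ∩ {ω | Y n ω = x}) * ENNReal.ofReal (Real.exp (-(totalRate (1 / 2) x * u))) := by
  have h1 := h.measure_jump_mem hA x hu (finite_jump x) (by
    rintro y (hy | hy)
    exacts [jumpRate_of_rightJump hy, jumpRate_of_leftJump hy])
  rw [ncard_jump, div_self (totalRate_pos x).ne', mul_one] at h1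
  rw [← h1, ← measure_inter_add_sdiff (A ∩ {ω | Y n ω = x} ∩ {ω | u < S n ω})
    (h.measurableSet_state (n + 1) {y | RightJump x y ∨ LeftJump x y})]
  have h2 := h.measure_not_jump hA x hu
  have e1 : A ∩ {ω | Y n ω = x} ∩ {ω | u < S n ω} ∩
      {ω | Y (n + 1) ω ∈ {y | RightJump x y ∨ LeftJump x y}} = A ∩ {ω | Y n ω = x} ∩
      {ω | u < S n ω ∧ Y (n + 1) ω ∈ {y | RightJump x y ∨ LeftJump x y}} := by
    rw [Set.inter_assoc]; rfl
  have e2 : (A ∩ {ω | Y n ω = x} ∩ {ω | u < S n ω}) \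
      {ω | Y (n + 1) ω ∈ {y | RightJump x y ∨ LeftJump x y}} = A ∩ {ω | Y n ω = x} ∩
      {ω | u < S n ω ∧ Y (n + 1) ω ∉ {y | RightJump x y ∨ LeftJump x y}} := by
    rw [Set.sdiff_eq, Set.inter_assoc]; rfl
  rw [e1, e2, h2, add_zero]

/-- The holding time, rescaled by the total rate of jumps, is exponential with parameter `1`
and independent of the past. -/
theorem measure_lt_rate_mul_time (h : IsJumpChain P Y S) (hA : MeasurableSet[past Y S n] A) {u : ℝ}
    (hu : 0 ≤ u) :
    P (A ∩ {ω | u < totalRate (1 / 2) (Y n ω) * S n ω}) =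
      P A * ENNReal.ofReal (Real.exp (-u)) := by
  have hm : Measurable fun ω => totalRate (1 / 2) (Y n ω) * S n ω :=
    ((measurable_from_top (f := totalRate (1 / 2))).comp (h.measurable_state n)).mul
      (h.measurable_time n)
  rw [measure_eq_tsum_fiber (h.measurable_state n)
      ((h.past_le n _ hA).inter (measurableSet_lt measurable_const hm)),
    measure_eq_tsum_fiber (h.measurable_state n) (h.past_le n _ hA), ← ENNReal.tsum_mul_right]
  refine tsum_congr fun x => ?_
  have hx := totalRate_pos x
  have h1 := h.measure_lt_time hA x (div_nonneg hu hx.le)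
  rw [mul_div_cancel₀ _ hx.ne'] at h1
  rw [← h1]
  congr 1
  ext ω
  simp only [Set.mem_inter_iff, Set.mem_ofPred_eq]
  constructor
  · rintro ⟨⟨ha, ht⟩, rfl⟩
    exact ⟨⟨ha, rfl⟩, by rwa [div_lt_iff₀' hx]⟩
  · rintro ⟨⟨ha, rfl⟩, ht⟩
    exact ⟨⟨ha, by rwa [div_lt_iff₀' hx] at ht⟩, rfl⟩

theorem ae_time_pos [IsProbabilityMeasure P] (h : IsJumpChain P Y S) (n : ℕ) :
    ∀ᵐ ω ∂P, 0 < S n ω := by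
  have h1 := h.measure_lt_rate_mul_time (n := n) MeasurableSet.univ le_rfl
  rw [neg_zero, Real.exp_zero, ENNReal.ofReal_one, mul_one, measure_univ, Set.univ_inter] at h1
  have hm : Measurable fun ω => totalRate (1 / 2) (Y n ω) * S n ω :=
    ((measurable_from_top (f := totalRate (1 / 2))).comp (h.measurable_state n)).mul
      (h.measurable_time n)
  have h2 := (prob_compl_eq_zero_iff (measurableSet_lt measurable_const hm)).2 h1
  filter_upwards [compl_mem_ae_iff.2 h2] with ω hω
  rw [compl_compl] at hω
  exact pos_of_mul_pos_right hω (totalRate_pos _).le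

theorem ae_jump [IsProbabilityMeasure P] (h : IsJumpChain P Y S) (n : ℕ) :
    ∀ᵐ ω ∂P, RightJump (Y n ω) (Y (n + 1) ω) ∨ LeftJump (Y n ω) (Y (n + 1) ω) := by
  have h1 : ∀ x : State, ∀ᵐ ω ∂P, ¬ (Y n ω = x ∧ 0 < S n ω ∧
      Y (n + 1) ω ∉ {y | RightJump x y ∨ LeftJump x y}) := by
    intro x
    have := h.measure_not_jump (n := n) MeasurableSet.univ x le_rfl
    rw [Set.univ_inter] at this
    exact measure_eq_zero_iff_ae_notMem.1 this
  filter_upwards [ae_all_iff.2 h1, h.ae_time_pos n] with ω h2 h3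
  by_contra h4
  exact h2 (Y n ω) ⟨rfl, h3, h4⟩

theorem measure_rightJump [IsProbabilityMeasure P] (h : IsJumpChain P Y S)
    (hA : MeasurableSet[past Y S n] A) (x : State) :
    P.real (A ∩ {ω | Y n ω = x} ∩ {ω | RightJump x (Y (n + 1) ω)}) =
      P.real (A ∩ {ω | Y n ω = x}) * (numRight x * (1 / 2) / totalRate (1 / 2) x) := by
  have h1 := h.measure_jump_mem hA x le_rfl (finite_rightJump x) fun y => jumpRate_of_rightJump
  rw [mul_zero, neg_zero, Real.exp_zero, one_mul, ncard_rightJump] at h1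
  have h2 : P (A ∩ {ω | Y n ω = x} ∩ {ω | 0 < S n ω ∧ Y (n + 1) ω ∈ {y | RightJump x y}}) =
      P (A ∩ {ω | Y n ω = x} ∩ {ω | RightJump x (Y (n + 1) ω)}) := by
    refine measure_congr ?_
    filter_upwards [h.ae_time_pos n] with ω hω
    refine propext ⟨fun h => ⟨h.1, h.2.2⟩, fun h => ⟨h.1, hω, h.2⟩⟩
  rw [Measure.real, ← h2, h1, ENNReal.toReal_mul, ENNReal.toReal_ofReal]
  · rfl
  · have := totalRate_pos x
    positivity

end IsJumpChain

/-! ### Conditional moments of the increments -/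

section Moments

variable {Ω : Type*} {m mΩ : MeasurableSpace Ω} {P : Measure Ω}

theorem condExp_add_sq_le [IsProbabilityMeasure P] (hm : m ≤ mΩ) {M ξ : Ω → ℝ} {c : ℝ}
    (hMm : StronglyMeasurable[m] M) (hM : MemLp M 2 P) (hξ : MemLp ξ 2 P)
    (h1 : P[ξ | m] =ᵐ[P] 0) (h2 : P[ξ ^ 2 | m] ≤ᵐ[P] fun _ => c) :
    P[(M + ξ) ^ 2 | m] ≤ᵐ[P] fun ω => M ω ^ 2 + c := by
  have e : (M + ξ) ^ 2 = M ^ 2 + (((2 : ℝ) • M) * ξ + ξ ^ 2) := by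
    ext ω
    simp
    ring
  have iM : Integrable (M ^ 2) P := hM.integrable_sq
  have iξ : Integrable (ξ ^ 2) P := hξ.integrable_sq
  have iMξ : Integrable (((2 : ℝ) • M) * ξ) P := by
    rw [smul_mul_assoc]
    exact (hM.integrable_mul hξ).smul (2 : ℝ)
  have a1 := condExp_add (m := m) iM (iMξ.add iξ)
  have a2 := condExp_add (m := m) iMξ iξ
  have a3 := condExp_mul_of_stronglyMeasurable_left (m := m) (hMm.const_smul (2 : ℝ)) iMξ
    (hξ.integrable one_le_two)
  have a4 := condExp_of_stronglyMeasurable hm (hMm.pow 2) iM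
  rw [e]
  filter_upwards [a1, a2, a3, h1, h2] with ω b1 b2 b3 b4 b5
  rw [b1, Pi.add_apply, a4, b2, Pi.add_apply, b3, Pi.mul_apply, b4]
  simp only [Pi.zero_apply, mul_zero, zero_add, Pi.pow_apply]
  gcongr

end Moments

/-- The mean holding time in a state. -/
noncomputable def meanTime (x : State) : ℝ := 1 / totalRate (1 / 2) x

theorem meanTime_pos (x : State) : 0 < meanTime x := one_div_pos.2 (totalRate_pos x)

theorem meanTime_le (x : State) : meanTime x ≤ 2 := by
  have := one_div_le_one_div_of_le (by norm_num) (half_le_totalRate x)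
  rw [meanTime]
  linarith

theorem abs_meanTime_le (x : State) : |meanTime x| ≤ 2 := by
  rw [abs_of_pos (meanTime_pos x)]
  exact meanTime_le x

section Increments

variable {Ω : Type*} (Y : ℕ → Ω → State) (S : ℕ → Ω → ℝ)

/-- The centred increment of the distance. -/
noncomputable def distIncr (n : ℕ) (ω : Ω) : ℝ :=
  D (Y (n + 1) ω) - D (Y n ω) - meanTime (Y n ω) / 2

/-- The centred holding time. -/
noncomputable def timeIncr (n : ℕ) (ω : Ω) : ℝ :=
  S n ω - meanTime (Y n ω)

/-- The holding time multiplied by the total rate of jumps. -/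
noncomputable def normTime (n : ℕ) (ω : Ω) : ℝ :=
  totalRate (1 / 2) (Y n ω) * S n ω

theorem timeIncr_eq (n : ℕ) :
    timeIncr Y S n = (fun ω => meanTime (Y n ω)) * (normTime Y S n - fun _ => 1) := by
  ext ω
  simp only [timeIncr, Pi.mul_apply, Pi.sub_apply, normTime, meanTime]
  have := (totalRate_pos (Y n ω)).ne'
  field_simp

theorem measurable_meanTime_past {i n : ℕ} (hi : i ≤ n) :
    Measurable[past Y S n] fun ω => meanTime (Y i ω) :=
  (measurable_from_top (f := meanTime)).comp (measurable_state_past hi)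

theorem measurable_D_past {i n : ℕ} (hi : i ≤ n) :
    Measurable[past Y S n] fun ω => (D (Y i ω) : ℝ) :=
  (measurable_from_top (f := fun x : State => (D x : ℝ))).comp (measurable_state_past hi)

end Increments

namespace IsJumpChain

variable {Ω : Type*} [mΩ : MeasurableSpace Ω] {P : Measure Ω} {Y : ℕ → Ω → State}
  {S : ℕ → Ω → ℝ}

theorem measurable_D (h : IsJumpChain P Y S) (n : ℕ) : Measurable fun ω => (D (Y n ω) : ℝ) :=
  (measurable_D_past Y S le_rfl).mono (h.past_le n) le_rfl

theorem measurable_meanTime (h : IsJumpChain P Y S) (n : ℕ) :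
    Measurable fun ω => meanTime (Y n ω) :=
  (measurable_meanTime_past Y S le_rfl).mono (h.past_le n) le_rfl

theorem measurable_distIncr (h : IsJumpChain P Y S) (n : ℕ) : Measurable (distIncr Y n) :=
  ((h.measurable_D (n + 1)).sub (h.measurable_D n)).sub ((h.measurable_meanTime n).div_const 2)

theorem measurable_normTime (h : IsJumpChain P Y S) (n : ℕ) : Measurable (normTime Y S n) :=
  ((measurable_from_top (f := totalRate (1 / 2))).comp (h.measurable_state n)).mul
    (h.measurable_time n)

theorem restrict_lt_normTime (h : IsJumpChain P Y S) {n : ℕ} {A : Set Ω}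
    (hA : MeasurableSet[past Y S n] A) (u : ℝ) (hu : 0 ≤ u) :
    P.restrict A {ω | u < normTime Y S n ω} =
      P.restrict A Set.univ * ENNReal.ofReal (Real.exp (-u)) := by
  rw [Measure.restrict_apply_univ, ← h.measure_lt_rate_mul_time hA hu,
    Measure.restrict_apply (measurableSet_lt measurable_const (h.measurable_normTime n)),
    Set.inter_comm]
  rfl

variable [IsProbabilityMeasure P]

theorem condExp_eq (h : IsJumpChain P Y S) {n : ℕ} {f g : Ω → ℝ} (hf : Integrable f P)
    (hgi : Integrable g P) (hg : Measurable[past Y S n] g)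
    (hfg : ∀ A, MeasurableSet[past Y S n] A → ∫ ω in A, f ω ∂P = ∫ ω in A, g ω ∂P) :
    P[f | past Y S n] =ᵐ[P] g :=
  (ae_eq_condExp_of_forall_setIntegral_eq (h.past_le n) hf (fun _ _ _ => hgi.integrableOn)
    (fun A hA _ => (hfg A hA).symm) hg.stronglyMeasurable.aestronglyMeasurable).symm

theorem ae_D_sub (h : IsJumpChain P Y S) (n : ℕ) :
    ∀ᵐ ω ∂P, (RightJump (Y n ω) (Y (n + 1) ω) ∧ (D (Y (n + 1) ω) : ℝ) - D (Y n ω) = 1) ∨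
      (¬ RightJump (Y n ω) (Y (n + 1) ω) ∧ (D (Y (n + 1) ω) : ℝ) - D (Y n ω) = -1) := by
  filter_upwards [h.ae_jump n] with ω hω
  rcases hω with hω | hω
  · left
    rw [hω.D_eq]
    exact ⟨hω, by push_cast; ring⟩
  · right
    rw [hω.D_eq]
    exact ⟨not_rightJump_of_leftJump hω, by push_cast; ring⟩

theorem ae_abs_distIncr_le (h : IsJumpChain P Y S) (n : ℕ) : ∀ᵐ ω ∂P, |distIncr Y n ω| ≤ 2 := by
  filter_upwards [h.ae_D_sub n] with ω hω
  have h1 := meanTime_pos (Y n ω)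
  have h2 := meanTime_le (Y n ω)
  rw [distIncr, abs_le]
  rcases hω with ⟨-, hω⟩ | ⟨-, hω⟩ <;> rw [hω] <;> constructor <;> linarith

theorem memLp_distIncr (h : IsJumpChain P Y S) (n : ℕ) : MemLp (distIncr Y n) 2 P :=
  MemLp.of_bound (h.measurable_distIncr n).aestronglyMeasurable 2 (h.ae_abs_distIncr_le n)

theorem condExp_distIncr_sq_le (h : IsJumpChain P Y S) (n : ℕ) :
    P[distIncr Y n ^ 2 | past Y S n] ≤ᵐ[P] fun _ => 4 := by
  have h1 : distIncr Y n ^ 2 ≤ᵐ[P] fun _ => (4 : ℝ) := by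
    filter_upwards [h.ae_abs_distIncr_le n] with ω hω
    rw [Pi.pow_apply, ← sq_abs]
    nlinarith [abs_nonneg (distIncr Y n ω)]
  have h2 := condExp_mono (m := past Y S n) (h.memLp_distIncr n).integrable_sq
    (integrable_const 4) h1
  rwa [condExp_const (h.past_le n)] at h2

/-- The distance minus half the sum of the mean holding times is a martingale: there is one more
possible jump to the right than to the left. -/
theorem condExp_distIncr (h : IsJumpChain P Y S) (n : ℕ) :
    P[distIncr Y n | past Y S n] =ᵐ[P] 0 := by
  have hi : Integrable (distIncr Y n) P := (h.memLp_distIncr n).integrable one_le_two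
  refine h.condExp_eq hi (integrable_zero _ _ _)
    (@measurable_zero _ _ _ (past Y S n) _) fun A hA => ?_
  refine setIntegral_congr_fiber (h.measurable_state n) (h.past_le n _ hA) hi
    (integrable_zero _ _ _) fun x => ?_
  set F := A ∩ {ω | Y n ω = x} with hF
  have hFm : MeasurableSet F := h.measurableSet_fiber hA x
  set R := {ω | RightJump x (Y (n + 1) ω)} with hR
  have hRm : MeasurableSet R := h.measurableSet_state (n + 1) {y | RightJump x y}
  have e : ∀ᵐ ω ∂P, ω ∈ F → distIncr Y n ω =
      R.indicator (fun _ => (2 : ℝ)) ω + (-1 - meanTime x / 2) := by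
    filter_upwards [h.ae_D_sub n] with ω hω hωF
    have hx : Y n ω = x := hωF.2
    rw [distIncr]
    rcases hω with ⟨h1, h2⟩ | ⟨h1, h2⟩ <;> rw [h2] <;> rw [hx] at h1 ⊢
    · rw [Set.indicator_of_mem (show ω ∈ R from h1)]
      ring
    · rw [Set.indicator_of_notMem (show ω ∉ R from h1)]
      ring
  rw [setIntegral_congr_ae hFm e, integral_add ((integrable_const 2).indicator hRm)
    (integrable_const _), setIntegral_indicator hRm, setIntegral_const, setIntegral_const,
    h.measure_rightJump hA x]
  simp only [Pi.zero_apply, integral_zero, smul_eq_mul]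
  have hr := (totalRate_pos x).ne'
  have hN : (numRight x : ℝ) = totalRate (1 / 2) x + 1 / 2 := by
    rw [totalRate_half, numRight_eq]
    push_cast
    ring
  rw [hN, meanTime]
  field_simp
  ring

theorem ae_normTime_nonneg (h : IsJumpChain P Y S) (n : ℕ) : 0 ≤ᵐ[P] normTime Y S n := by
  filter_upwards [h.ae_time_pos n] with ω hω
  exact mul_nonneg (totalRate_pos _).le hω.le

theorem memLp_normTime (h : IsJumpChain P Y S) (n : ℕ) : MemLp (normTime Y S n) 2 P := by
  have := h.restrict_lt_normTime (n := n) MeasurableSet.univ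
  rw [Measure.restrict_univ] at this
  exact memLp_two_of_exponential_tail (h.measurable_normTime n).aemeasurable
    (h.ae_normTime_nonneg n) this

theorem condExp_normTime (h : IsJumpChain P Y S) (n : ℕ) :
    P[normTime Y S n | past Y S n] =ᵐ[P] fun _ => 1 := by
  refine h.condExp_eq ((h.memLp_normTime n).integrable one_le_two) (integrable_const 1)
    measurable_const fun A hA => ?_
  rw [integral_of_exponential_tail (h.measurable_normTime n).aemeasurable
    (ae_restrict_of_ae (h.ae_normTime_nonneg n)) (h.restrict_lt_normTime hA), integral_const,
    smul_eq_mul, mul_one]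

theorem condExp_normTime_sq (h : IsJumpChain P Y S) (n : ℕ) :
    P[normTime Y S n ^ 2 | past Y S n] =ᵐ[P] fun _ => 2 := by
  refine h.condExp_eq (h.memLp_normTime n).integrable_sq (integrable_const 2)
    measurable_const fun A hA => ?_
  simp only [Pi.pow_apply]
  rw [integral_sq_of_exponential_tail (h.measurable_normTime n).aemeasurable
    (ae_restrict_of_ae (h.ae_normTime_nonneg n)) (h.restrict_lt_normTime hA), integral_const,
    smul_eq_mul, mul_comm]

theorem memLp_timeIncr (h : IsJumpChain P Y S) (n : ℕ) : MemLp (timeIncr Y S n) 2 P := by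
  rw [timeIncr_eq]
  exact MemLp.mul (r := 2) (p := ∞) (q := 2) ((h.memLp_normTime n).sub (memLp_const 1))
    (memLp_top_of_bound (h.measurable_meanTime n).aestronglyMeasurable 2
      (ae_of_all _ fun ω => abs_meanTime_le _))

theorem condExp_timeIncr (h : IsJumpChain P Y S) (n : ℕ) :
    P[timeIncr Y S n | past Y S n] =ᵐ[P] 0 := by
  have hi := (h.memLp_normTime n).integrable one_le_two
  have h1 := condExp_stronglyMeasurable_mul_of_bound (h.past_le n)
    (measurable_meanTime_past Y S le_rfl).stronglyMeasurable
    (hi.sub (integrable_const 1)) 2 (ae_of_all _ fun ω => abs_meanTime_le (Y n ω))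
  have h2 := condExp_sub hi (integrable_const (1 : ℝ)) (past Y S n)
  rw [condExp_const (h.past_le n)] at h2
  rw [timeIncr_eq]
  filter_upwards [h1, h2, h.condExp_normTime n] with ω a1 a2 a3
  rw [a1, Pi.mul_apply, a2, Pi.sub_apply, a3]
  simp

theorem condExp_timeIncr_sq_le (h : IsJumpChain P Y S) (n : ℕ) :
    P[timeIncr Y S n ^ 2 | past Y S n] ≤ᵐ[P] fun _ => 4 := by
  have hi := (h.memLp_normTime n).integrable one_le_two
  have hi2 := (h.memLp_normTime n).integrable_sq
  -- the conditional second moment of the centred exponential variable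
  have h0 : P[(normTime Y S n - fun _ => 1) ^ 2 | past Y S n] =ᵐ[P] fun _ => 1 := by
    have e : (normTime Y S n - fun _ => 1) ^ 2 =
        normTime Y S n ^ 2 - ((2 : ℝ) • normTime Y S n - fun _ => 1) := by
      ext ω
      simp
      ring
    have h1 := condExp_sub (m := past Y S n) (f := normTime Y S n ^ 2) hi2
      ((hi.smul (2 : ℝ)).sub (integrable_const 1))
    have h2 := condExp_sub (m := past Y S n) (hi.smul (2 : ℝ)) (integrable_const (1 : ℝ))
    have h3 := condExp_smul (2 : ℝ) (normTime Y S n) (past Y S n) (μ := P)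
    rw [condExp_const (h.past_le n)] at h2
    rw [e]
    filter_upwards [h1, h2, h3, h.condExp_normTime n, h.condExp_normTime_sq n]
      with ω a1 a2 a3 a4 a5
    rw [a1, Pi.sub_apply, a2, Pi.sub_apply, a3, Pi.smul_apply, a4, a5]
    norm_num
  have h1 := condExp_stronglyMeasurable_mul_of_bound (h.past_le n)
    ((measurable_meanTime_past Y S le_rfl).pow_const 2).stronglyMeasurable
    ((h.memLp_normTime n).sub (memLp_const 1)).integrable_sq 4 (ae_of_all P fun ω => by
      rw [norm_pow, Real.norm_eq_abs]
      have := abs_meanTime_le (Y n ω)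
      nlinarith [abs_nonneg (meanTime (Y n ω))])
  rw [timeIncr_eq, mul_pow]
  filter_upwards [h0, h1] with ω a0 a1
  refine a1.trans_le ?_
  rw [Pi.mul_apply]
  refine (congrArg _ a0).trans_le ?_
  have := meanTime_le (Y n ω)
  have := meanTime_pos (Y n ω)
  nlinarith

end IsJumpChain

/-! ### The supermartingale -/

/-- One step of the supermartingale, for the fourth roots `a` and `b` of `1 + τ` before and after it,
the value `z` of the normalized squares and the total rate `r`. -/
theorem one_add_mul_exp_le {a b z r : ℝ} (ha : 1 ≤ a) (hab : a ≤ b) (hz : 0 ≤ z) (hr : 0 < r)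
    (h : b ^ 4 - a ^ 4 = 1 / r) (hra : r ≤ 6 * (1 + z) * a ^ 2) :
    (1 + z + 8 / b ^ 7) * Real.exp (192 / b) ≤ (1 + z) * Real.exp (192 / a) := by
  have ha0 : 0 < a := by linarith
  have hb0 : 0 < b := by linarith
  have h1 : 1 = r * (b ^ 4 - a ^ 4) := by
    rw [h]
    field_simp
  have hd : 0 ≤ b ^ 4 - a ^ 4 := by
    rw [h]
    positivity
  -- the discrete analogue of the fact that `-4 / b` is an antiderivative of `1 / b ^ 5` with
  -- respect to `b ^ 4`
  have h2 : (b ^ 4 - a ^ 4) * a ^ 2 / b ^ 7 ≤ 4 * (1 / a - 1 / b) := by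
    have e : 4 * (1 / a - 1 / b) = 4 * (b - a) / (a * b) := by
      field_simp
    rw [e, div_le_div_iff₀ (by positivity) (by positivity)]
    have h3 : (b + a) * (b ^ 2 + a ^ 2) * a ^ 3 ≤ (b + b) * (b ^ 2 + b ^ 2) * b ^ 3 := by gcongr
    have h4 := mul_le_mul_of_nonneg_left h3 (mul_nonneg (sub_nonneg.2 hab) hb0.le)
    calc (b ^ 4 - a ^ 4) * a ^ 2 * (a * b)
        = (b - a) * b * ((b + a) * (b ^ 2 + a ^ 2) * a ^ 3) := by ring
      _ ≤ (b - a) * b * ((b + b) * (b ^ 2 + b ^ 2) * b ^ 3) := h4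
      _ = 4 * (b - a) * b ^ 7 := by ring
  have h5 : 8 / b ^ 7 ≤ (1 + z) * (192 / a - 192 / b) := by
    calc 8 / b ^ 7 = 8 * (r * (b ^ 4 - a ^ 4)) / b ^ 7 := by rw [← h1, mul_one]
      _ ≤ 8 * (6 * (1 + z) * a ^ 2 * (b ^ 4 - a ^ 4)) / b ^ 7 := by gcongr
      _ = 48 * (1 + z) * ((b ^ 4 - a ^ 4) * a ^ 2 / b ^ 7) := by ring
      _ ≤ 48 * (1 + z) * (4 * (1 / a - 1 / b)) := by gcongr
      _ = (1 + z) * (192 / a - 192 / b) := by ring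
  have h6 := Real.add_one_le_exp (192 / a - 192 / b)
  calc (1 + z + 8 / b ^ 7) * Real.exp (192 / b)
      ≤ (1 + z + (1 + z) * (192 / a - 192 / b)) * Real.exp (192 / b) := by gcongr
    _ = (1 + z) * (192 / a - 192 / b + 1) * Real.exp (192 / b) := by ring
    _ ≤ (1 + z) * Real.exp (192 / a - 192 / b) * Real.exp (192 / b) := by gcongr
    _ = (1 + z) * Real.exp (192 / a) := by
        rw [mul_assoc, ← Real.exp_add, sub_add_cancel]

section Processes

variable {Ω : Type*} (Y : ℕ → Ω → State) (S : ℕ → Ω → ℝ)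

/-- The sum of the mean holding times before the `n`-th jump. -/
noncomputable def clock (n : ℕ) (ω : Ω) : ℝ := ∑ k ∈ Finset.range n, meanTime (Y k ω)

/-- The martingale given by the centred increments of the distance. -/
noncomputable def distMart (n : ℕ) : Ω → ℝ := ∑ k ∈ Finset.range n, distIncr Y k

/-- The martingale given by the centred holding times. -/
noncomputable def timeMart (n : ℕ) : Ω → ℝ := ∑ k ∈ Finset.range n, timeIncr Y S k

/-- The fourth root of one plus the sum of the mean holding times. -/
noncomputable def rootClock (n : ℕ) (ω : Ω) : ℝ := (1 + clock Y n ω) ^ (1 / 4 : ℝ)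

/-- The sum of the squares of the two martingales, divided by the `7/4`-th power of `1 + clock`. -/
noncomputable def normSq (n : ℕ) (ω : Ω) : ℝ :=
  (distMart Y n ω ^ 2 + timeMart Y S n ω ^ 2) / rootClock Y n ω ^ 7

/-- A nonnegative supermartingale that dominates the normalized squares of the two martingales. -/
noncomputable def lyapunov (n : ℕ) (ω : Ω) : ℝ :=
  (1 + normSq Y S n ω) * Real.exp (192 / rootClock Y n ω)

theorem clock_nonneg (n : ℕ) (ω : Ω) : 0 ≤ clock Y n ω :=
  Finset.sum_nonneg fun _ _ => (meanTime_pos _).le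

theorem clock_succ (n : ℕ) (ω : Ω) : clock Y (n + 1) ω = clock Y n ω + meanTime (Y n ω) :=
  Finset.sum_range_succ _ _

theorem rootClock_pow (n : ℕ) (ω : Ω) : rootClock Y n ω ^ 4 = 1 + clock Y n ω := by
  rw [rootClock, ← Real.rpow_natCast, ← Real.rpow_mul (by linarith [clock_nonneg Y n ω])]
  norm_num

theorem one_le_rootClock (n : ℕ) (ω : Ω) : 1 ≤ rootClock Y n ω :=
  Real.one_le_rpow (by linarith [clock_nonneg Y n ω]) (by norm_num)

theorem rootClock_pos (n : ℕ) (ω : Ω) : 0 < rootClock Y n ω :=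
  one_pos.trans_le (one_le_rootClock Y n ω)

theorem rootClock_le_succ (n : ℕ) (ω : Ω) : rootClock Y n ω ≤ rootClock Y (n + 1) ω := by
  refine Real.rpow_le_rpow (by linarith [clock_nonneg Y n ω]) ?_ (by norm_num)
  rw [clock_succ]
  linarith [meanTime_pos (Y n ω)]

theorem normSq_nonneg (n : ℕ) (ω : Ω) : 0 ≤ normSq Y S n ω := by
  have := rootClock_pos Y n ω
  rw [normSq]
  positivity

theorem one_add_normSq_le_lyapunov (n : ℕ) (ω : Ω) : 1 + normSq Y S n ω ≤ lyapunov Y S n ω := by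
  have h1 := normSq_nonneg Y S n ω
  have h2 := rootClock_pos Y n ω
  exact le_mul_of_one_le_right (by positivity) (Real.one_le_exp (by positivity))

theorem lyapunov_nonneg (n : ℕ) (ω : Ω) : 0 ≤ lyapunov Y S n ω := by
  linarith [one_add_normSq_le_lyapunov Y S n ω, normSq_nonneg Y S n ω]

theorem D_eq_distMart (n : ℕ) (ω : Ω) :
    (D (Y n ω) : ℝ) = D (Y 0 ω) + distMart Y n ω + clock Y n ω / 2 := by
  induction n with
  | zero => simp [distMart, clock]
  | succ n ih =>
    rw [clock_succ, distMart, Finset.sum_range_succ, ← distMart, Pi.add_apply, distIncr]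
    linarith

theorem sum_time_eq_timeMart (n : ℕ) (ω : Ω) :
    ∑ k ∈ Finset.range n, S k ω = timeMart Y S n ω + clock Y n ω := by
  rw [timeMart, clock, Finset.sum_apply, ← Finset.sum_add_distrib]
  simp [timeIncr]

/-- The total rate is of lower order than the clock, up to fluctuations of the distance that are
controlled by the normalized squares. -/
theorem totalRate_le_rootClock (n : ℕ) {ω : Ω} (h0 : Y 0 ω = origin) :
    totalRate (1 / 2) (Y n ω) ≤ 6 * (1 + normSq Y S n ω) * rootClock Y n ω ^ 2 := by
  set z := normSq Y S n ω with hz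
  set θ := rootClock Y n ω with hθ
  have hz0 : 0 ≤ z := normSq_nonneg Y S n ω
  have hθ1 : 1 ≤ θ := one_le_rootClock Y n ω
  have hD := D_eq_distMart Y n ω
  have hc := rootClock_pow Y n ω
  have hc0 := clock_nonneg Y n ω
  rw [h0, D_origin, Nat.cast_zero, zero_add] at hD
  have hM : distMart Y n ω ≤ (1 + z) * θ ^ 4 := by
    refine le_of_sq_le_sq ?_ (by positivity)
    calc distMart Y n ω ^ 2 ≤ distMart Y n ω ^ 2 + timeMart Y S n ω ^ 2 := by
          linarith [sq_nonneg (timeMart Y S n ω)]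
      _ = z * θ ^ 7 := by rw [hz, normSq, div_mul_cancel₀ _ (by positivity)]
      _ ≤ (1 + z) ^ 2 * θ ^ 8 := by
          gcongr
          · nlinarith
          · norm_num
      _ = ((1 + z) * θ ^ 4) ^ 2 := by ring
  have hr := totalRate_sq_le (Y n ω)
  refine le_of_sq_le_sq (hr.trans ?_) (by positivity)
  have h1 : 1 + (D (Y n ω) : ℝ) ≤ 2 * (1 + z) * θ ^ 4 := by
    nlinarith [pow_pos (one_pos.trans_le hθ1) 4]
  calc 18 * (1 + (D (Y n ω) : ℝ)) ≤ 18 * (2 * (1 + z) * θ ^ 4) := by linarith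
    _ = 36 * (1 + z) * θ ^ 4 * 1 := by ring
    _ ≤ 36 * (1 + z) * θ ^ 4 * (1 + z) := by gcongr; linarith
    _ = (6 * (1 + z) * θ ^ 2) ^ 2 := by ring

/-- The left-hand side is the value of `lyapunov` after the next jump, with the squares of the
martingales replaced by bounds on their conditional expectations. -/
theorem lyapunov_step (n : ℕ) {ω : Ω} (h0 : Y 0 ω = origin) :
    Real.exp (192 / rootClock Y (n + 1) ω) + Real.exp (192 / rootClock Y (n + 1) ω) /
      rootClock Y (n + 1) ω ^ 7 * (distMart Y n ω ^ 2 + 4 + (timeMart Y S n ω ^ 2 + 4)) ≤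
      lyapunov Y S n ω := by
  have h1 := rootClock_le_succ Y n ω
  have h2 := rootClock_pos Y n ω
  have h3 : rootClock Y (n + 1) ω ^ 4 - rootClock Y n ω ^ 4 = 1 / totalRate (1 / 2) (Y n ω) := by
    rw [rootClock_pow, rootClock_pow, clock_succ, ← meanTime]
    ring
  refine le_trans ?_ (one_add_mul_exp_le (one_le_rootClock Y n ω) h1 (normSq_nonneg Y S n ω)
    (totalRate_pos (Y n ω)) h3 (totalRate_le_rootClock Y S n h0))
  set b := rootClock Y (n + 1) ω
  have hb : 0 < b := h2.trans_le h1
  have h4 : (distMart Y n ω ^ 2 + timeMart Y S n ω ^ 2) / b ^ 7 ≤ normSq Y S n ω := by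
    rw [normSq]
    gcongr
  calc Real.exp (192 / b) + Real.exp (192 / b) / b ^ 7 *
        (distMart Y n ω ^ 2 + 4 + (timeMart Y S n ω ^ 2 + 4))
      = (1 + (distMart Y n ω ^ 2 + timeMart Y S n ω ^ 2) / b ^ 7 + 8 / b ^ 7) *
          Real.exp (192 / b) := by ring
    _ ≤ _ := by gcongr

theorem measurable_clock_past {i n : ℕ} (hi : i ≤ n + 1) : Measurable[past Y S n] (clock Y i) := by
  refine Finset.measurable_fun_sum _ fun k hk => measurable_meanTime_past Y S ?_
  have := Finset.mem_range.1 hk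
  omega

theorem measurable_rootClock_past {i n : ℕ} (hi : i ≤ n + 1) :
    Measurable[past Y S n] (rootClock Y i) :=
  (measurable_const.add (measurable_clock_past Y S hi)).pow_const _

theorem measurable_distMart_past (n : ℕ) : Measurable[past Y S n] (distMart Y n) := by
  have h : ∀ k ∈ Finset.range n, Measurable[past Y S n] (distIncr Y k) := by
    intro k hk
    have := Finset.mem_range.1 hk
    exact ((measurable_D_past Y S this).sub (measurable_D_past Y S this.le)).sub
      ((measurable_meanTime_past Y S this.le).div_const 2)
  rw [distMart, Finset.sum_fn]
  exact Finset.measurable_sum _ h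

theorem measurable_timeMart_past (n : ℕ) : Measurable[past Y S n] (timeMart Y S n) := by
  have h : ∀ k ∈ Finset.range n, Measurable[past Y S n] (timeIncr Y S k) := by
    intro k hk
    have := Finset.mem_range.1 hk
    exact (measurable_time_past this).sub (measurable_meanTime_past Y S this.le)
  rw [timeMart, Finset.sum_fn]
  exact Finset.measurable_sum _ h

/-- The exponential factor of the supermartingale. -/
noncomputable def expFactor (n : ℕ) (ω : Ω) : ℝ := Real.exp (192 / rootClock Y n ω)

/-- The weight of the squares of the martingales in the supermartingale. -/
noncomputable def sqWeight (n : ℕ) (ω : Ω) : ℝ := expFactor Y n ω / rootClock Y n ω ^ 7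

theorem lyapunov_eq (n : ℕ) :
    lyapunov Y S n = expFactor Y n + sqWeight Y n * (distMart Y n ^ 2 + timeMart Y S n ^ 2) := by
  ext ω
  simp only [lyapunov, normSq, expFactor, sqWeight, Pi.add_apply, Pi.mul_apply, Pi.pow_apply]
  ring

theorem measurable_expFactor_past {i n : ℕ} (hi : i ≤ n + 1) :
    Measurable[past Y S n] (expFactor Y i) :=
  Real.measurable_exp.comp (measurable_const.div (measurable_rootClock_past Y S hi))

theorem measurable_sqWeight_past {i n : ℕ} (hi : i ≤ n + 1) :
    Measurable[past Y S n] (sqWeight Y i) :=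
  (measurable_expFactor_past Y S hi).div ((measurable_rootClock_past Y S hi).pow_const 7)

theorem expFactor_pos (n : ℕ) (ω : Ω) : 0 < expFactor Y n ω := Real.exp_pos _

theorem sqWeight_nonneg (n : ℕ) (ω : Ω) : 0 ≤ sqWeight Y n ω :=
  div_nonneg (expFactor_pos Y n ω).le (pow_nonneg (rootClock_pos Y n ω).le 7)

theorem norm_expFactor_le (n : ℕ) (ω : Ω) : ‖expFactor Y n ω‖ ≤ Real.exp 192 := by
  rw [Real.norm_of_nonneg (expFactor_pos Y n ω).le]
  exact Real.exp_le_exp.2 (div_le_self (by norm_num) (one_le_rootClock Y n ω))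

theorem norm_sqWeight_le (n : ℕ) (ω : Ω) : ‖sqWeight Y n ω‖ ≤ Real.exp 192 := by
  refine le_trans ?_ (norm_expFactor_le Y n ω)
  rw [Real.norm_of_nonneg (sqWeight_nonneg Y n ω), Real.norm_of_nonneg (expFactor_pos Y n ω).le]
  exact div_le_self (expFactor_pos Y n ω).le (one_le_pow₀ (one_le_rootClock Y n ω))

end Processes

namespace IsJumpChain

variable {Ω : Type*} [mΩ : MeasurableSpace Ω] {P : Measure Ω} [IsProbabilityMeasure P]
  {Y : ℕ → Ω → State} {S : ℕ → Ω → ℝ}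

theorem memLp_distMart (h : IsJumpChain P Y S) (n : ℕ) : MemLp (distMart Y n) 2 P :=
  memLp_finsetSum' _ fun k _ => h.memLp_distIncr k

theorem memLp_timeMart (h : IsJumpChain P Y S) (n : ℕ) : MemLp (timeMart Y S n) 2 P :=
  memLp_finsetSum' _ fun k _ => h.memLp_timeIncr k

theorem integrable_expFactor (h : IsJumpChain P Y S) (n : ℕ) : Integrable (expFactor Y n) P :=
  Integrable.of_bound ((measurable_expFactor_past Y S n.le_succ).mono
    (h.past_le n) le_rfl).aestronglyMeasurable _ (ae_of_all _ (norm_expFactor_le Y n))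

theorem integrable_sq_add_sq (h : IsJumpChain P Y S) (n : ℕ) :
    Integrable (distMart Y n ^ 2 + timeMart Y S n ^ 2) P :=
  (h.memLp_distMart n).integrable_sq.add (h.memLp_timeMart n).integrable_sq

theorem integrable_sqWeight_mul (h : IsJumpChain P Y S) (n : ℕ) :
    Integrable (sqWeight Y n * (distMart Y n ^ 2 + timeMart Y S n ^ 2)) P :=
  (h.integrable_sq_add_sq n).bdd_mul ((measurable_sqWeight_past Y S n.le_succ).mono
    (h.past_le n) le_rfl).aestronglyMeasurable (ae_of_all _ (norm_sqWeight_le Y n))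

theorem integrable_lyapunov (h : IsJumpChain P Y S) (n : ℕ) : Integrable (lyapunov Y S n) P := by
  rw [lyapunov_eq]
  exact (h.integrable_expFactor n).add (h.integrable_sqWeight_mul n)

theorem condExp_lyapunov_le (h : IsJumpChain P Y S) (n : ℕ) :
    P[lyapunov Y S (n + 1) | past Y S n] ≤ᵐ[P] lyapunov Y S n := by
  have hm := h.past_le n
  have a1 := condExp_add (m := past Y S n) (h.integrable_expFactor (n + 1))
    (h.integrable_sqWeight_mul (n + 1))
  have a2 := condExp_of_stronglyMeasurable hm
    (measurable_expFactor_past Y S (le_refl (n + 1))).stronglyMeasurable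
    (h.integrable_expFactor (n + 1))
  have a3 := condExp_stronglyMeasurable_mul_of_bound hm
    (measurable_sqWeight_past Y S (le_refl (n + 1))).stronglyMeasurable
    (h.integrable_sq_add_sq (n + 1)) _ (ae_of_all P (norm_sqWeight_le Y (n + 1)))
  have a4 := condExp_add (m := past Y S n) (f := distMart Y (n + 1) ^ 2)
    (g := timeMart Y S (n + 1) ^ 2) (h.memLp_distMart (n + 1)).integrable_sq
    (h.memLp_timeMart (n + 1)).integrable_sq
  have a5 := condExp_add_sq_le hm (measurable_distMart_past Y S n).stronglyMeasurable
    (h.memLp_distMart n) (h.memLp_distIncr n) (h.condExp_distIncr n) (h.condExp_distIncr_sq_le n)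
  have a6 := condExp_add_sq_le hm (measurable_timeMart_past Y S n).stronglyMeasurable
    (h.memLp_timeMart n) (h.memLp_timeIncr n) (h.condExp_timeIncr n) (h.condExp_timeIncr_sq_le n)
  have e1 : distMart Y n + distIncr Y n = distMart Y (n + 1) := (Finset.sum_range_succ _ _).symm
  have e2 : timeMart Y S n + timeIncr Y S n = timeMart Y S (n + 1) :=
    (Finset.sum_range_succ _ _).symm
  rw [e1] at a5
  rw [e2] at a6
  rw [lyapunov_eq Y S (n + 1)]
  filter_upwards [a1, a3, a4, a5, a6, h.init] with ω b1 b3 b4 b5 b6 b0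
  rw [b1, Pi.add_apply, a2, b3, Pi.mul_apply, b4, Pi.add_apply]
  refine le_trans ?_ (lyapunov_step Y S n b0)
  exact add_le_add_right (mul_le_mul_of_nonneg_left (add_le_add b5 b6) (sqWeight_nonneg Y _ ω)) _

theorem supermartingale_lyapunov (h : IsJumpChain P Y S) :
    Supermartingale (lyapunov Y S) h.filtration P := by
  refine supermartingale_nat (fun n => ?_) h.integrable_lyapunov h.condExp_lyapunov_le
  rw [lyapunov_eq]
  exact ((measurable_expFactor_past Y S n.le_succ).add
    ((measurable_sqWeight_past Y S n.le_succ).mul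
      (((measurable_distMart_past Y S n).pow_const 2).add
        ((measurable_timeMart_past Y S n).pow_const 2)))).stronglyMeasurable

theorem ae_normSq_bounded (h : IsJumpChain P Y S) :
    ∀ᵐ ω ∂P, ∃ C, ∀ n, normSq Y S n ω ≤ C := by
  have hs := h.supermartingale_lyapunov
  have hb : ∀ n, eLpNorm ((-lyapunov Y S) n) 1 P ≤ (∫ ω, lyapunov Y S 0 ω ∂P).toNNReal := by
    intro n
    rw [Pi.neg_apply, eLpNorm_neg, eLpNorm_one_eq_lintegral_enorm,
      ← ofReal_integral_norm_eq_lintegral_enorm (h.integrable_lyapunov n)]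
    refine ENNReal.ofReal_le_ofReal ?_
    have h1 := hs.setIntegral_le (Nat.zero_le n) (s := Set.univ) MeasurableSet.univ
    simp only [setIntegral_univ] at h1
    simpa only [Real.norm_of_nonneg (lyapunov_nonneg Y S n _)] using h1
  filter_upwards [hs.neg.ae_tendsto_limitProcess hb] with ω hω
  obtain ⟨C, hC⟩ := hω.bddBelow_range
  refine ⟨-C, fun n => ?_⟩
  have h1 : C ≤ -lyapunov Y S n ω := hC ⟨n, rfl⟩
  linarith [one_add_normSq_le_lyapunov Y S n ω]

end IsJumpChain

/-! ### Convergence along a path -/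

section Paths

variable {Ω : Type*} {Y : ℕ → Ω → State} {S : ℕ → Ω → ℝ} {ω : Ω}

theorem D_le_of_jump (h0 : Y 0 ω = origin)
    (hj : ∀ n, RightJump (Y n ω) (Y (n + 1) ω) ∨ LeftJump (Y n ω) (Y (n + 1) ω)) (n : ℕ) :
    D (Y n ω) ≤ n := by
  induction n with
  | zero => rw [h0, D_origin]
  | succ n ih => rcases hj n with h | h <;> have := h.D_eq <;> omega

theorem tendsto_clock (h0 : Y 0 ω = origin)
    (hj : ∀ n, RightJump (Y n ω) (Y (n + 1) ω) ∨ LeftJump (Y n ω) (Y (n + 1) ω)) :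
    Tendsto (fun n => clock Y n ω) atTop atTop := by
  have h1 := Real.tendsto_sum_range_one_div_nat_succ_atTop.const_mul_atTop
    (show (0 : ℝ) < 1 / 18 by norm_num)
  refine tendsto_atTop_mono (fun n => ?_) h1
  rw [Finset.mul_sum, clock]
  refine Finset.sum_le_sum fun k _ => ?_
  have h2 := totalRate_sq_le (Y k ω)
  have h3 : (D (Y k ω) : ℝ) ≤ k := by exact_mod_cast D_le_of_jump h0 hj k
  have hk : (0 : ℝ) ≤ k := Nat.cast_nonneg k
  have h4 : totalRate (1 / 2) (Y k ω) ≤ 18 * (k + 1) := by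
    refine le_of_sq_le_sq ?_ (by positivity)
    nlinarith
  rw [meanTime, div_mul_div_comm, one_mul]
  exact one_div_le_one_div_of_le (totalRate_pos _) h4

theorem tendsto_rootClock (hc : Tendsto (fun n => clock Y n ω) atTop atTop) :
    Tendsto (fun n => rootClock Y n ω) atTop atTop :=
  (tendsto_rpow_atTop (by norm_num)).comp (tendsto_atTop_add_const_left _ 1 hc)

/-- A sequence with squares bounded by a multiple of the `7/4`-th power of `1 + clock` is negligible
compared with the clock. -/
theorem tendsto_div_of_sq_le (hc : Tendsto (fun n => clock Y n ω) atTop atTop) {M : ℕ → ℝ} {C : ℝ}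
    (hM : ∀ n, M n ^ 2 ≤ C * rootClock Y n ω ^ 7) :
    Tendsto (fun n => M n / (1 + clock Y n ω)) atTop (𝓝 0) := by
  have h1 : Tendsto (fun n => C / rootClock Y n ω) atTop (𝓝 0) :=
    (tendsto_rootClock hc).const_div_atTop C
  have h2 : Tendsto (fun n => (M n / (1 + clock Y n ω)) ^ 2) atTop (𝓝 0) := by
    refine squeeze_zero (fun n => sq_nonneg _) (fun n => ?_) h1
    have hp := rootClock_pos Y n ω
    rw [← rootClock_pow, div_pow, div_le_div_iff₀ (by positivity) hp]
    calc M n ^ 2 * rootClock Y n ω ≤ C * rootClock Y n ω ^ 7 * rootClock Y n ω := by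
          gcongr
          exact hM n
      _ = C * (rootClock Y n ω ^ 4) ^ 2 := by ring
  rw [tendsto_zero_iff_abs_tendsto_zero]
  have h3 := h2.sqrt
  simpa only [Real.sqrt_sq_eq_abs, Real.sqrt_zero, Function.comp_def] using h3

theorem tendsto_clock_div (hc : Tendsto (fun n => clock Y n ω) atTop atTop) :
    Tendsto (fun n => clock Y n ω / (1 + clock Y n ω)) atTop (𝓝 1) := by
  have h1 : Tendsto (fun n => 1 - 1 / (1 + clock Y n ω)) atTop (𝓝 (1 - 0)) :=
    tendsto_const_nhds.sub ((tendsto_atTop_add_const_left _ 1 hc).const_div_atTop 1)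
  rw [sub_zero] at h1
  refine h1.congr fun n => ?_
  have := clock_nonneg Y n ω
  field_simp
  ring

theorem tendsto_clock_succ_div (hc : Tendsto (fun n => clock Y n ω) atTop atTop) :
    Tendsto (fun n => (1 + clock Y (n + 1) ω) / (1 + clock Y n ω)) atTop (𝓝 1) := by
  have h1 : Tendsto (fun n => meanTime (Y n ω) / (1 + clock Y n ω)) atTop (𝓝 0) := by
    refine squeeze_zero (fun n => ?_) (fun n => ?_)
      ((tendsto_atTop_add_const_left _ 1 hc).const_div_atTop 2)
    · have := clock_nonneg Y n ω
      have := meanTime_pos (Y n ω)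
      positivity
    · have := clock_nonneg Y n ω
      have := meanTime_le (Y n ω)
      gcongr
  have h2 := h1.const_add 1
  rw [add_zero] at h2
  refine h2.congr fun n => ?_
  have := clock_nonneg Y n ω
  rw [clock_succ]
  field_simp
  ring

/-- Along the jump times, the distance is asymptotic to half the clock and the jump times are
asymptotic to the clock. -/
theorem tendsto_D_div_and_time_div (h0 : Y 0 ω = origin)
    (hc : Tendsto (fun n => clock Y n ω) atTop atTop) {C : ℝ} (hC : ∀ n, normSq Y S n ω ≤ C) :
    Tendsto (fun n => (D (Y n ω) : ℝ) / (1 + clock Y n ω)) atTop (𝓝 (1 / 2)) ∧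
      Tendsto (fun n => (∑ k ∈ Finset.range n, S k ω) / (1 + clock Y n ω)) atTop (𝓝 1) := by
  have hb : ∀ n, distMart Y n ω ^ 2 + timeMart Y S n ω ^ 2 ≤ C * rootClock Y n ω ^ 7 := by
    intro n
    have := hC n
    rwa [normSq, div_le_iff₀ (pow_pos (rootClock_pos Y n ω) 7)] at this
  have h1 := tendsto_div_of_sq_le hc (M := fun n => distMart Y n ω) fun n => by
    linarith [hb n, sq_nonneg (timeMart Y S n ω)]
  have h2 := tendsto_div_of_sq_le hc (M := fun n => timeMart Y S n ω) fun n => by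
    linarith [hb n, sq_nonneg (distMart Y n ω)]
  have h3 := tendsto_clock_div hc
  constructor
  · have h4 := h1.add (h3.div_const 2)
    rw [zero_add] at h4
    refine h4.congr fun n => ?_
    rw [D_eq_distMart Y n ω, h0, D_origin, Nat.cast_zero]
    ring
  · have h4 := h2.add h3
    rw [zero_add] at h4
    refine h4.congr fun n => ?_
    rw [sum_time_eq_timeMart Y S n ω]
    ring

end Paths

/-- A nonnegative process that is constant between the times `T n` of a sequence tending to
infinity has the growth rate that it has along the sequence, if the ratio of successive times
tends to one; the latter is expressed by the two limits `h1` and `h2`. -/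
theorem tendsto_div_of_tendsto_jump {T d : ℕ → ℝ} {x : ℝ≥0 → ℝ} {c : ℝ} (hT0 : T 0 = 0)
    (hT : Tendsto T atTop atTop) (hd : ∀ n, 0 ≤ d n)
    (hx : ∀ (n : ℕ) (t : ℝ≥0), T n ≤ t → (t : ℝ) < T (n + 1) → x t = d n)
    (h1 : Tendsto (fun n => d n / T n) atTop (𝓝 c))
    (h2 : Tendsto (fun n => d n / T (n + 1)) atTop (𝓝 c)) :
    Tendsto (fun t : ℝ≥0 => x t / t) atTop (𝓝 c) := by
  classical
  have hex : ∀ t : ℝ≥0, ∃ n, (t : ℝ) < T (n + 1) := fun t =>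
    (((tendsto_add_atTop_iff_nat 1).2 hT).eventually_gt_atTop (t : ℝ)).exists
  have hN1 : ∀ t : ℝ≥0, T (Nat.find (hex t)) ≤ t := by
    intro t
    rcases Nat.eq_zero_or_pos (Nat.find (hex t)) with h | h
    · rw [h, hT0]
      exact t.2
    · have := Nat.find_min (hex t) (Nat.sub_one_lt h.ne')
      rwa [Nat.sub_one_add_one h.ne', not_lt] at this
  have hN2 : ∀ t : ℝ≥0, (t : ℝ) < T (Nat.find (hex t) + 1) := fun t => Nat.find_spec (hex t)
  have hN : Tendsto (fun t : ℝ≥0 => Nat.find (hex t)) atTop atTop := by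
    refine tendsto_atTop.2 fun m => ?_
    obtain ⟨B, hB⟩ := ((Finset.range (m + 1)).image T).bddAbove
    filter_upwards [eventually_ge_atTop B.toNNReal] with t ht
    by_contra! h
    have h3 : T (Nat.find (hex t) + 1) ≤ B :=
      hB (Finset.mem_coe.2 (Finset.mem_image_of_mem _ (Finset.mem_range.2 (by omega))))
    have h4 : B ≤ t := (Real.le_coe_toNNReal B).trans (NNReal.coe_le_coe.2 ht)
    exact absurd (hN2 t) (not_lt.2 (h3.trans h4))
  refine tendsto_of_tendsto_of_tendsto_of_le_of_le' (h2.comp hN) (h1.comp hN) ?_ ?_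
  · filter_upwards [eventually_gt_atTop 0] with t ht
    rw [Function.comp_apply, hx _ t (hN1 t) (hN2 t)]
    have : (0 : ℝ) < t := ht
    exact div_le_div_of_nonneg_left (hd _) this (hN2 t).le
  · filter_upwards [hN.eventually (hT.eventually_gt_atTop 0)] with t ht
    rw [Function.comp_apply, hx _ t (hN1 t) (hN2 t)]
    exact div_le_div_of_nonneg_left (hd _) ht (hN1 t)

end Exclusion

theorem lemma3p2 {Ω : Type*} [MeasurableSpace Ω] (P : Measure Ω) [IsProbabilityMeasure P]
    (X : ℝ≥0 → Ω → Exclusion.State) (hX : Exclusion.IsExclusionProcess (1 / 2) P X) :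
    ∀ᵐ ω ∂P, Tendsto (fun t : ℝ≥0 => (Exclusion.D (X t ω) : ℝ) / (t : ℝ)) atTop (𝓝 (1 / 2)) := by
  obtain ⟨Y, S, hY, hS, hinit, htrans, hpath⟩ := hX
  have h : Exclusion.IsJumpChain P Y S := ⟨hY, hS, hinit, htrans⟩
  filter_upwards [hinit, hpath, ae_all_iff.2 h.ae_jump, h.ae_normSq_bounded] with ω h0 hω hj hb
  obtain ⟨C, hC⟩ := hb
  have hc := Exclusion.tendsto_clock h0 hj
  have hc1 := tendsto_atTop_add_const_left _ (1 : ℝ) hc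
  obtain ⟨hD, hT⟩ := Exclusion.tendsto_D_div_and_time_div h0 hc hC
  have hc0 : ∀ n, 1 + Exclusion.clock Y n ω ≠ 0 := fun n => by
    linarith [Exclusion.clock_nonneg Y n ω]
  have hT' : Tendsto (fun n => (∑ k ∈ Finset.range (n + 1), S k ω) / (1 + Exclusion.clock Y n ω))
      atTop (𝓝 1) := by
    have h1 := ((tendsto_add_atTop_iff_nat 1).2 hT).mul (Exclusion.tendsto_clock_succ_div hc)
    rw [one_mul] at h1
    exact h1.congr fun n => div_mul_div_cancel₀ (hc0 (n + 1))
  refine Exclusion.tendsto_div_of_tendsto_jump (T := fun n => ∑ k ∈ Finset.range n, S k ω)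
    (d := fun n => (Exclusion.D (Y n ω) : ℝ)) (by simp) ?_ (fun n => Nat.cast_nonneg _)
    (fun n t h1 h2 => by rw [hω n t h1 h2]) ?_ ?_
  · refine (hT.pos_mul_atTop one_pos hc1).congr fun n => ?_
    exact div_mul_cancel₀ _ (hc0 n)
  · have h1 := hD.div hT one_ne_zero
    rw [div_one] at h1
    exact h1.congr fun n => div_div_div_cancel_right₀ (hc0 n) _ _
  · have h1 := hD.div hT' one_ne_zero
    rw [div_one] at h1
    exact h1.congr fun n => div_div_div_cancel_right₀ (hc0 n) _ _
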